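/- Let $d\ge 1$ and $m,n\ge 0$ be integers, $\mathcal A=\mathbb Z[v,v^{-1}]$, $q=v^2$. **Weyl group and Hecke algebra.** Let $W$ be the Weyl group of type $B_d$, i.e. the group of permutations $w$ of $[-d..d]=\{-d,\dots,d\}$ with $w(-i)=-w(i)$, generated by $S=\{s_0,\dots,s_{d-1}\}$, where $s_0=(-1,1)$ and $s_k=(k,k+1)(-k,-k-1)$ for $1\le k<d$; let $\ell$ be its length function. The Hecke algebra $\mathcal H=\mathcal H(B_d)$ is the free $\mathcal A$-module with basis $\{T_w\mid w\in W\}$ and multiplication determined by $T_wT_{w'}=T_{ww'}$ if $\ell(ww')=\ell(w)+\ell(w')$, and $(T_{s_k}+1)(T_{s_k}-q)=0$ for $0\le k<d$. **Signed $q$-permutation modules.** Let $\Lambda(m|n,d)$ be the set of $\lambda=(\lambda_0,\dots,\lambda_{m+n})\in\mathbb N^{m+n+1}$ with $\sum_r\lambda_r=d$, and put $\tilde\lambda_r=\lambda_0+\dots+\lambda_r$. Let $W_\lambda=\langle S_\lambda\rangle$, where $S_\lambda=S\setminus\{s_{\tilde\lambda_0},\dots,s_{\tilde\lambda_{m+n-1}}\}$,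 let $W_{\lambda^{(0)}}=\langle s_k\in S_\lambda\mid k<\tilde\lambda_m\rangle$ and $W_{\lambda^{(1)}}=\langle s_k\in S_\lambda\mid k>\tilde\lambda_m\rangle$, and let $\mathcal D_\lambda$ be the set of shortest representatives of the right cosets $W_\lambda g$ in $W$. Put $$[xy]_\lambda=\Big(\sum_{w\in W_{\lambda^{(0)}}}T_w\Big)\Big(\sum_{w\in W_{\lambda^{(1)}}}(-q)^{-\ell(w)}T_w\Big)\in\mathcal H .$$ **Tuples.** Let $\mathbb I=[-(m+n)..m+n]$, with parity $\widehat i=0$ if $|i|\le m$ and $\widehat i=1$ otherwise. The group $W$ acts on $\mathbb I^d$ from the right by $\mathbf i s_0=(-i_1,i_2,\dots,i_d)$ and $\mathbf i s_k=(\dots,i_{k+1},i_k,\dots)$ for $1\le k<d$. Let $\mathbf i_\lambda=(0,\dots,0,1,\dots,1,\dots,m+n,\dots,m+n)$, where $r$ occurs $\lambda_r$ times. For $\mathbf i\in\mathbb I^d$ let $\widehat{\mathbf i}\in\{0,1\}$ and $|\mathbf i|\in\mathbb N$ be given by $$\widehat{\mathbf i}\equiv\Big(\sum_{k<l,\ i_k>i_l}+\sum_{k\le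 l,\ -i_k>i_l}\Big)\widehat{i_k}\,\widehat{i_l}\pmod 2,\qquad |\mathbf i|=\#\{k<l\mid i_k>i_l\}+\#\{k\le l\mid -i_k>i_l\},$$ with $k,l\in[1..d]$. **Tensor superspace.** Let $V_{m|n}$ be the free $\mathcal A$-module with basis $\{e_i\mid i\in\mathbb I\}$, and put $\mathbf e_{\mathbf i}=v^{|\mathbf i|}e_{i_1}\otimes\dots\otimes e_{i_d}\in V_{m|n}^{\otimes d}$. **Theorem.** (a) For every $\mathbf i\in\mathbb I^d$ there is a unique pair $(\mu,g)$ with $\mu\in\Lambda(m|n,d)$, $g\in\mathcal D_\mu$ and $\mathbf i=\mathbf i_\mu g$. (b) There is a unique ($\mathcal A$-linear) right action of $\mathcal H$ on $V_{m|n}^{\otimes d}$ such that, for all $\mathbf i\in\mathbb I^d$ and $1\le k<d$, $$\mathbf e_{\mathbf i}T_{s_k}=\begin{cases}(-1)^{\widehat{i_k}\widehat{i_{k+1}}}\mathbf e_{\mathbf i s_k},& i_k<i_{k+1},\\ (-1)^{\widehat{i_k}}q^{1-\widehat{i_k}}\,\mathbf e_{\mathbf i},& i_k=i_{k+1},\\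 (-1)^{\widehat{i_k}\widehat{i_{k+1}}}q\,\mathbf e_{\mathbf i s_k}+(q-1)\mathbf e_{\mathbf i},& i_k>i_{k+1},\end{cases}\qquad \mathbf e_{\mathbf i}T_{s_0}=\begin{cases}(-1)^{\widehat{i_1}}\mathbf e_{\mathbf i s_0},& i_1>0,\\ q\,\mathbf e_{\mathbf i},& i_1=0,\\ (-1)^{\widehat{i_1}}q\,\mathbf e_{\mathbf i s_0}+(q-1)\mathbf e_{\mathbf i},& i_1<0.\end{cases}$$ (c) For this action there is an isomorphism of right $\mathcal H$-modules $$\phi:V_{m|n}^{\otimes d}\longrightarrow\bigoplus_{\lambda\in\Lambda(m|n,d)}[xy]_\lambda\mathcal H,\qquad (-1)^{\widehat{\mathbf i}}\,\mathbf e_{\mathbf i}\longmapsto[xy]_\mu T_g\ \text{ in the summand } \mu ,$$ where $\mu$ and $g\in\mathcal D_\mu$ are as in (a). -/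

import Mathlib

namespace TypeB

/-- The integral interval `[-N..N]`. -/
abbrev SymInterval (N : ℕ) : Type := Set.Icc (-(N : ℤ)) (N : ℤ)

instance (N : ℕ) : Neg (SymInterval N) :=
  ⟨fun x => ⟨-x.1, by have h := x.2; simp only [Set.mem_Icc] at h ⊢; omega⟩⟩

theorem coe_neg {N : ℕ} (x : SymInterval N) : ((-x : SymInterval N) : ℤ) = -(x : ℤ) := rfl

/-- The number `k`, for `0 ≤ k ≤ N`, as an element of `[-N..N]`. -/
def pt {N : ℕ} (k : ℕ) (hk : k ≤ N) : SymInterval N :=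
  ⟨(k : ℤ), by simp only [Set.mem_Icc]; omega⟩

theorem coe_pt {N : ℕ} (k : ℕ) (hk : k ≤ N) : ((pt k hk : SymInterval N) : ℤ) = k := rfl

/-- The Weyl group of type `B_d`: permutations `w` of `[-d..d]` with `w(-i) = -w(i)`. -/
def W (d : ℕ) : Subgroup (Equiv.Perm (SymInterval d)) where
  carrier := {w | ∀ i, w (-i) = -w i}
  one_mem' := fun _ => rfl
  mul_mem' := by
    intro a b ha hb i
    rw [Equiv.Perm.mul_apply, hb, ha, Equiv.Perm.mul_apply]
  inv_mem' := by
    intro a ha i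
    rw [Equiv.Perm.inv_eq_iff_eq, ha]
    simp

/-- The underlying permutation of the simple reflection: `(-1, 1)` if `k = 0`, and
`(k, k+1)(-k, -k-1)` if `1 ≤ k < d`. -/
def simplePerm {d : ℕ} (k : Fin d) : Equiv.Perm (SymInterval d) :=
  if k.1 = 0 then Equiv.swap (-(pt (k.1 + 1) k.2)) (pt (k.1 + 1) k.2)
  else Equiv.swap (pt k.1 k.2.le) (pt (k.1 + 1) k.2) *
    Equiv.swap (-(pt k.1 k.2.le)) (-(pt (k.1 + 1) k.2))

theorem coe_simplePerm {d : ℕ} (k : Fin d) (x : SymInterval d) :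
    ((simplePerm k x : SymInterval d) : ℤ) =
      if (x : ℤ) = k then (if (k : ℕ) = 0 then 0 else (k : ℤ) + 1)
      else if (x : ℤ) = k + 1 then (if (k : ℕ) = 0 then -1 else (k : ℤ))
      else if (x : ℤ) = -(k : ℤ) then -((k : ℤ) + 1)
      else if (x : ℤ) = -((k : ℤ) + 1) then (if (k : ℕ) = 0 then 1 else -(k : ℤ))
      else x := by
  unfold simplePerm
  split_ifs <;>
    simp only [Equiv.Perm.mul_apply, Equiv.swap_apply_def, Subtype.ext_iff, coe_neg, coe_pt,
      apply_ite Subtype.val] <;>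
    push_cast at * <;> split_ifs <;> omega

/-- The simple reflections `s_0, …, s_{d-1}`. -/
def s {d : ℕ} (k : Fin d) : W d :=
  ⟨simplePerm k, by
    intro x
    apply Subtype.ext
    rw [coe_neg, coe_simplePerm, coe_simplePerm, coe_neg]
    split_ifs <;> omega⟩

theorem coe_s {d : ℕ} (k : Fin d) (x : SymInterval d) :
    (((s k).1 x : SymInterval d) : ℤ) =
      if (x : ℤ) = k then (if (k : ℕ) = 0 then 0 else (k : ℤ) + 1)
      else if (x : ℤ) = k + 1 then (if (k : ℕ) = 0 then -1 else (k : ℤ))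
      else if (x : ℤ) = -(k : ℤ) then -((k : ℤ) + 1)
      else if (x : ℤ) = -((k : ℤ) + 1) then (if (k : ℕ) = 0 then 1 else -(k : ℤ))
      else x := coe_simplePerm k x

theorem s_mul_self {d : ℕ} (k : Fin d) : s k * s k = 1 := by
  apply Subtype.ext
  apply Equiv.ext
  intro x
  apply Subtype.ext
  change (((s k).1 ((s k).1 x) : SymInterval d) : ℤ) = x
  have h1 := coe_s k x
  have h2 := coe_s k ((s k).1 x)
  split_ifs at h1 h2 <;> omega

theorem s_inv {d : ℕ} (k : Fin d) : (s k)⁻¹ = s k := inv_eq_of_mul_eq_one_left (s_mul_self k)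

theorem W_neg {d : ℕ} (w : W d) (x : SymInterval d) : w.1 (-x) = -w.1 x := w.2 x

theorem coe_pt_zero {d : ℕ} (w : W d) : ((w.1 (pt 0 (Nat.zero_le d)) : SymInterval d) : ℤ) = 0 := by
  have h := congrArg Subtype.val (W_neg w (pt 0 (Nat.zero_le d)))
  have e : (-(pt 0 (Nat.zero_le d)) : SymInterval d) = pt 0 (Nat.zero_le d) :=
    Subtype.ext (by rw [coe_neg, coe_pt]; simp)
  rw [e, coe_neg] at h
  omega

/-- An auxiliary function on `W`, used to show that the simple reflections generate. -/
noncomputable def potential {d : ℕ} (w : W d) : ℤ := ∑ x : SymInterval d, (x : ℤ) * (w.1 x : ℤ)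

theorem potential_lt {d : ℕ} (w : W d) (k : Fin d)
    (h : ((w.1 (pt (k.1 + 1) k.2) : SymInterval d) : ℤ) < (w.1 (pt k.1 k.2.le) : SymInterval d)) :
    potential w < potential (w * s k) := by
  have e1 : potential (w * s k) = ∑ x : SymInterval d, ((s k).1 x : ℤ) * (w.1 x : ℤ) := by
    unfold potential
    rw [← Equiv.sum_comp (s k).1]
    refine Finset.sum_congr rfl fun x _ => ?_
    have : (w * s k).1 ((s k).1 x) = w.1 x := by
      change (w * s k * s k).1 x = w.1 x
      rw [mul_assoc, s_mul_self, mul_one]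
    rw [this]
  have e2 : potential (w * s k) - potential w =
      ∑ x : SymInterval d, ((if x = pt k.1 k.2.le then (w.1 (pt k.1 k.2.le) : ℤ) else 0)
        + (if x = -pt k.1 k.2.le then (w.1 (pt k.1 k.2.le) : ℤ) else 0)
        - (if x = pt (k.1 + 1) k.2 then (w.1 (pt (k.1 + 1) k.2) : ℤ) *
            (if k.1 = 0 then 2 else 1) else 0)
        - (if x = -pt (k.1 + 1) k.2 then (w.1 (pt (k.1 + 1) k.2) : ℤ) *
            (if k.1 = 0 then 2 else 1) else 0)) := by
    rw [e1, potential, ← Finset.sum_sub_distrib]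
    refine Finset.sum_congr rfl fun x _ => ?_
    rw [← sub_mul, coe_s]
    have hz := coe_pt_zero w
    have hp := congrArg Subtype.val (W_neg w (pt k.1 k.2.le))
    have hq := congrArg Subtype.val (W_neg w (pt (k.1 + 1) k.2))
    rw [coe_neg] at hp hq
    by_cases c1 : x = pt k.1 k.2.le
    · subst c1
      by_cases k0 : k.1 = 0
      · have : ((w.1 (pt k.1 k.2.le) : SymInterval d) : ℤ) = 0 := by
          simpa only [k0] using hz
        rw [this]
        simp [Subtype.ext_iff, coe_neg, coe_pt]
        omega
      · have n1 : (pt k.1 k.2.le : SymInterval d) ≠ -pt k.1 k.2.le := by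
          rw [Ne, Subtype.ext_iff, coe_neg, coe_pt]; omega
        have n2 : (pt k.1 k.2.le : SymInterval d) ≠ pt (k.1 + 1) k.2 := by
          rw [Ne, Subtype.ext_iff, coe_pt, coe_pt]; omega
        have n3 : (pt k.1 k.2.le : SymInterval d) ≠ -pt (k.1 + 1) k.2 := by
          rw [Ne, Subtype.ext_iff, coe_neg, coe_pt, coe_pt]; omega
        simp [n1, n2, n3, coe_pt, k0]
    · by_cases c2 : x = -pt k.1 k.2.le
      · subst c2
        have k0 : k.1 ≠ 0 := by
          intro k0; apply c1; rw [Subtype.ext_iff, coe_neg, coe_pt]; omega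
        have n2 : (-pt k.1 k.2.le : SymInterval d) ≠ pt (k.1 + 1) k.2 := by
          rw [Ne, Subtype.ext_iff, coe_neg, coe_pt, coe_pt]; omega
        have n3 : (-pt k.1 k.2.le : SymInterval d) ≠ -pt (k.1 + 1) k.2 := by
          rw [Ne, Subtype.ext_iff, coe_neg, coe_neg, coe_pt, coe_pt]; omega
        rw [hp, coe_neg, coe_pt]
        rw [if_neg (by omega), if_neg (by omega), if_pos rfl, if_neg c1, if_pos rfl, if_neg n2,
          if_neg n3]
        ring
      · have c1' : (x : ℤ) ≠ k := fun h => c1 (Subtype.ext h)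
        have c2' : (x : ℤ) ≠ -k := fun h => c2 (Subtype.ext h)
        by_cases c3 : x = pt (k.1 + 1) k.2
        · subst c3
          have n3 : (pt (k.1 + 1) k.2 : SymInterval d) ≠ -pt (k.1 + 1) k.2 := by
            rw [Ne, Subtype.ext_iff, coe_neg, coe_pt]; omega
          rw [if_neg c1', if_pos (by rw [coe_pt]; push_cast; rfl), if_neg c1, if_neg c2, if_pos rfl,
            if_neg n3, coe_pt]
          by_cases k0 : k.1 = 0
          · simp only [k0, if_true]; push_cast; ring
          · simp only [k0, if_false]; push_cast; ring
        · have c3' : (x : ℤ) ≠ k + 1 := fun h => c3 (Subtype.ext (by rw [h, coe_pt]; push_cast; rfl))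
          rw [if_neg c1', if_neg c3', if_neg c2', if_neg c1, if_neg c2, if_neg c3]
          by_cases c4 : x = -pt (k.1 + 1) k.2
          · subst c4
            rw [hq, if_pos (by rw [coe_neg, coe_pt]; push_cast; rfl), if_pos rfl, coe_neg, coe_pt]
            by_cases k0 : k.1 = 0
            · simp only [k0, if_true]; push_cast; ring
            · simp only [k0, if_false]; push_cast; ring
          · have c4' : (x : ℤ) ≠ -((k : ℤ) + 1) :=
              fun h => c4 (Subtype.ext (by rw [h, coe_neg, coe_pt]; push_cast; rfl))
            rw [if_neg c4', if_neg c4]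
            ring
  have hz := coe_pt_zero w
  simp only [Finset.sum_add_distrib, Finset.sum_sub_distrib, Finset.sum_ite_eq', Finset.mem_univ,
    if_true] at e2
  by_cases k0 : k.1 = 0
  · have : ((w.1 (pt k.1 k.2.le) : SymInterval d) : ℤ) = 0 := by simpa only [k0] using hz
    rw [if_pos k0] at e2
    omega
  · rw [if_neg k0] at e2
    omega

theorem eq_one_of_no_descent {d : ℕ} (w : W d)
    (h : ∀ k : Fin d, ((w.1 (pt k.1 k.2.le) : SymInterval d) : ℤ) ≤
      (w.1 (pt (k.1 + 1) k.2) : SymInterval d)) : w = 1 := by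
  have h' : ∀ k : Fin d, ((w.1 (pt k.1 k.2.le) : SymInterval d) : ℤ) <
      (w.1 (pt (k.1 + 1) k.2) : SymInterval d) := by
    intro k
    refine lt_of_le_of_ne (h k) fun e => ?_
    have := congrArg Subtype.val (w.1.injective (Subtype.ext e))
    rw [coe_pt, coe_pt] at this
    omega
  have lo : ∀ j (hj : j ≤ d), (j : ℤ) ≤ (w.1 (pt j hj) : SymInterval d) := by
    intro j
    induction j with
    | zero => intro hj; rw [coe_pt_zero]; simp
    | succ j ih => intro hj; have h1 := h' ⟨j, hj⟩; have := ih (by omega); dsimp only at h1; push_cast; omega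
  have hi : ∀ t j (hj : j ≤ d), d = j + t → ((w.1 (pt j hj) : SymInterval d) : ℤ) ≤ j := by
    intro t
    induction t with
    | zero => intro j hj e; have := (w.1 (pt j hj)).2.2; omega
    | succ t ih =>
      intro j hj e
      have h1 := h' ⟨j, by omega⟩
      dsimp only at h1
      have := ih (j + 1) (by omega) (by omega)
      push_cast at this
      omega
  have key : ∀ j (hj : j ≤ d), w.1 (pt j hj) = pt j hj := fun j hj =>
    Subtype.ext (le_antisymm (hi (d - j) j hj (by omega)) (lo j hj))
  apply Subtype.ext
  apply Equiv.ext
  intro x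
  have hx := x.2
  rw [Set.mem_Icc] at hx
  rcases le_total 0 (x : ℤ) with h0 | h0
  · have : x = pt (x : ℤ).toNat (by omega) := Subtype.ext (by rw [coe_pt]; omega)
    rw [this, key]; rfl
  · have : x = -pt (-(x : ℤ)).toNat (by omega) := Subtype.ext (by rw [coe_neg, coe_pt]; omega)
    rw [this, W_neg, key]; rfl

/-- Every element of `W` is a product of simple reflections. -/
theorem exists_word {d : ℕ} (w : W d) : ∃ L : List (Fin d), (L.map s).prod = w := by
  obtain ⟨u, ⟨L, hL⟩, hu⟩ := Set.exists_max_image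
    {u : W d | ∃ L : List (Fin d), w * (L.map s).prod = u} potential (Set.toFinite _)
    ⟨w, [], by simp⟩
  have : u = 1 := by
    apply eq_one_of_no_descent
    intro k
    by_contra hk
    have h1 := potential_lt u k (not_le.mp hk)
    have h2 := hu (u * s k) ⟨L ++ [k], by simp [← hL, mul_assoc]⟩
    omega
  refine ⟨L.reverse, ?_⟩
  have e : ∀ L : List (Fin d), (L.reverse.map s).prod = ((L.map s).prod)⁻¹ := by
    intro L
    induction L with
    | nil => simp
    | cons a L ih =>
      simp only [List.reverse_cons, List.map_append, List.prod_append, ih, List.map_cons,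
        List.map_nil, List.prod_cons, List.prod_nil, mul_one, mul_inv_rev, s_inv]
  rw [e]
  rw [this] at hL
  exact (eq_inv_of_mul_eq_one_left hL).symm

/-- The length function: the least number of simple reflections with product `w`. -/
noncomputable def length {d : ℕ} (w : W d) : ℕ :=
  sInf {n : ℕ | ∃ L : List (Fin d), L.length = n ∧ (L.map s).prod = w}

theorem exists_reduced {d : ℕ} (w : W d) :
    ∃ L : List (Fin d), L.length = length w ∧ (L.map s).prod = w := by
  obtain ⟨L, hL⟩ := exists_word w
  exact Nat.sInf_mem (s := {n : ℕ | ∃ L : List (Fin d), L.length = n ∧ (L.map s).prod = w})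
    ⟨_, L, rfl, hL⟩

theorem length_le {d : ℕ} (L : List (Fin d)) : length (L.map s).prod ≤ L.length :=
  Nat.sInf_le ⟨L, rfl, rfl⟩

theorem length_one {d : ℕ} : length (1 : W d) = 0 := Nat.le_zero.mp (length_le [])

theorem length_mul_le {d : ℕ} (u w : W d) : length (u * w) ≤ length u + length w := by
  obtain ⟨L, hL, rfl⟩ := exists_reduced u
  obtain ⟨M, hM, rfl⟩ := exists_reduced w
  rw [← hL, ← hM, ← List.length_append, ← List.prod_append, ← List.map_append]
  exact length_le _

theorem length_s_le {d : ℕ} (k : Fin d) : length (s k) ≤ 1 := by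
  simpa using length_le [k]

theorem length_inv_le {d : ℕ} (w : W d) : length w⁻¹ ≤ length w := by
  obtain ⟨L, hL, e⟩ := exists_reduced w
  have : (L.reverse.map s).prod = w⁻¹ := by
    rw [← e]
    clear hL e
    induction L with
    | nil => simp
    | cons a L ih =>
      simp only [List.reverse_cons, List.map_append, List.prod_append, ih, List.map_cons,
        List.map_nil, List.prod_cons, List.prod_nil, mul_one, mul_inv_rev, s_inv]
  rw [← this, ← hL, ← List.length_reverse]
  exact length_le _

theorem length_inv {d : ℕ} (w : W d) : length w⁻¹ = length w :=
  le_antisymm (length_inv_le w) (by simpa using length_inv_le w⁻¹)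

/-- `k` is an ascent of `w` if `w(k) < w(k+1)`. -/
def Asc {d : ℕ} (w : W d) (k : Fin d) : Prop :=
  ((w.1 (pt k.1 k.2.le) : SymInterval d) : ℤ) < (w.1 (pt (k.1 + 1) k.2) : SymInterval d)

theorem not_asc {d : ℕ} {w : W d} {k : Fin d} (h : ¬ Asc w k) :
    ((w.1 (pt (k.1 + 1) k.2) : SymInterval d) : ℤ) < (w.1 (pt k.1 k.2.le) : SymInterval d) := by
  refine lt_of_le_of_ne (not_lt.mp h) fun e => ?_
  have := congrArg Subtype.val (w.1.injective (Subtype.ext e))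
  rw [coe_pt, coe_pt] at this
  omega

theorem asc_one {d : ℕ} (k : Fin d) : Asc (1 : W d) k := by
  change ((pt k.1 k.2.le : SymInterval d) : ℤ) < (pt (k.1 + 1) k.2 : SymInterval d)
  rw [coe_pt, coe_pt]; omega

theorem asc_mul_s {d : ℕ} (w : W d) (k : Fin d) : Asc (w * s k) k ↔ ¬ Asc w k := by
  have hz := coe_pt_zero w
  have e1 := coe_s k (pt (k.1 + 1) k.2)
  rw [coe_pt] at e1
  have e2 := coe_s k (pt k.1 k.2.le)
  rw [coe_pt] at e2
  have hq := congrArg Subtype.val (W_neg w (pt (k.1 + 1) k.2))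
  rw [coe_neg] at hq
  have d1 : Asc w k ∨ ¬ Asc w k := em _
  have d2 : ¬ Asc w k → _ := not_asc
  by_cases k0 : k.1 = 0
  · have f1 : (s k).1 (pt (k.1 + 1) k.2) = -pt (k.1 + 1) k.2 := by
      apply Subtype.ext; rw [e1, coe_neg, coe_pt]; split_ifs <;> omega
    have f2 : (s k).1 (pt k.1 k.2.le) = pt k.1 k.2.le := by
      apply Subtype.ext; rw [e2, coe_pt]; split_ifs <;> omega
    have : ((w.1 (pt k.1 k.2.le) : SymInterval d) : ℤ) = 0 := by simpa only [k0] using hz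
    unfold Asc at *
    change ((w.1 ((s k).1 (pt k.1 k.2.le)) : SymInterval d) : ℤ) <
      (w.1 ((s k).1 (pt (k.1 + 1) k.2)) : SymInterval d) ↔ _
    rw [f1, f2]
    omega
  · have f1 : (s k).1 (pt (k.1 + 1) k.2) = pt k.1 k.2.le := by
      apply Subtype.ext; rw [e1, coe_pt]; split_ifs <;> omega
    have f2 : (s k).1 (pt k.1 k.2.le) = pt (k.1 + 1) k.2 := by
      apply Subtype.ext; rw [e2, coe_pt]; split_ifs <;> omega
    unfold Asc at *
    change ((w.1 ((s k).1 (pt k.1 k.2.le)) : SymInterval d) : ℤ) <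
      (w.1 ((s k).1 (pt (k.1 + 1) k.2)) : SymInterval d) ↔ _
    rw [f1, f2]
    omega

set_option maxHeartbeats 2000000 in
/-- If `s_j` flips the order of `u(k)` and `u(k+1)` then `s_j u = u s_k`. -/
theorem s_mul_eq_of_flip_aux {d : ℕ} (u : W d) (j k : Fin d) (h1 : Asc u k)
    (h2 : ¬ Asc (s j * u) k) : s j * u = u * s k := by
  have hz := coe_pt_zero u
  have h3 := not_asc h2
  change (((s j).1 (u.1 (pt (k.1 + 1) k.2)) : SymInterval d) : ℤ) <
    ((s j).1 (u.1 (pt k.1 k.2.le)) : SymInterval d) at h3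
  unfold Asc at h1
  have g1 := coe_s j (u.1 (pt (k.1 + 1) k.2))
  have g2 := coe_s j (u.1 (pt k.1 k.2.le))
  have hp := congrArg Subtype.val (W_neg u (pt k.1 k.2.le))
  have hq := congrArg Subtype.val (W_neg u (pt (k.1 + 1) k.2))
  rw [coe_neg] at hp hq
  have inj : ∀ x y : SymInterval d, (u.1 x : ℤ) = (u.1 y : ℤ) → (x : ℤ) = y := fun x y h =>
    congrArg Subtype.val (u.1.injective (Subtype.ext h))
  have i0 := inj (pt k.1 k.2.le) (pt 0 (Nat.zero_le d))
  have i1 := inj (pt (k.1 + 1) k.2) (pt 0 (Nat.zero_le d))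
  have i2 := inj (pt (k.1 + 1) k.2) (-pt k.1 k.2.le)
  rw [coe_pt, coe_pt] at i0 i1
  rw [coe_neg, coe_pt, coe_pt] at i2
  have i3 : k.1 = 0 → ((u.1 (pt k.1 k.2.le) : SymInterval d) : ℤ) = 0 := by
    intro k0; simpa only [k0] using hz
  have main : (k.1 = 0 ∧ j.1 = 0 ∧ ((u.1 (pt (k.1 + 1) k.2) : SymInterval d) : ℤ) = 1) ∨
      (k.1 ≠ 0 ∧ j.1 ≠ 0 ∧ ((((u.1 (pt k.1 k.2.le) : SymInterval d) : ℤ) = j ∧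
        ((u.1 (pt (k.1 + 1) k.2) : SymInterval d) : ℤ) = j + 1) ∨
        (((u.1 (pt k.1 k.2.le) : SymInterval d) : ℤ) = -(j + 1) ∧
        ((u.1 (pt (k.1 + 1) k.2) : SymInterval d) : ℤ) = -j))) := by
    push_cast at *
    rw [g1, g2] at h3
    split_ifs at h3 <;> omega
  clear g1 g2 h3 h2
  apply Subtype.ext
  apply Equiv.ext
  intro x
  apply Subtype.ext
  change (((s j).1 (u.1 x) : SymInterval d) : ℤ) = (u.1 ((s k).1 x) : SymInterval d)
  have e := coe_s k x
  have f := coe_s j (u.1 x)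
  have t1 : ∀ y : SymInterval d, (y : ℤ) = k → y = pt k.1 k.2.le := fun y h => Subtype.ext h
  have t2 : ∀ y : SymInterval d, (y : ℤ) = k + 1 → y = pt (k.1 + 1) k.2 := fun y h =>
    Subtype.ext (by rw [h, coe_pt]; push_cast; rfl)
  have t3 : ∀ y : SymInterval d, (y : ℤ) = -k → y = -pt k.1 k.2.le := fun y h => Subtype.ext h
  have t4 : ∀ y : SymInterval d, (y : ℤ) = -(k + 1) → y = -pt (k.1 + 1) k.2 := fun y h =>
    Subtype.ext (by rw [h, coe_neg, coe_pt]; push_cast; rfl)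
  have j1 := inj x (pt k.1 k.2.le)
  have j2 := inj x (pt (k.1 + 1) k.2)
  have j3 := inj x (-pt k.1 k.2.le)
  have j4 := inj x (-pt (k.1 + 1) k.2)
  rw [coe_pt] at j1 j2
  rw [coe_neg, coe_pt] at j3 j4
  rw [f]
  by_cases c1 : (x : ℤ) = k
  · have ex := t1 x c1
    rw [if_pos c1] at e
    have ey : (s k).1 x = if k.1 = 0 then pt k.1 k.2.le else pt (k.1 + 1) k.2 := by
      split_ifs at e ⊢
      · exact t1 _ (by omega)
      · exact t2 _ (by omega)
    rw [ey, ex]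
    clear j1 j2 j3 j4 t1 t2 t3 t4 e f ey inj
    split_ifs <;> omega
  · by_cases c2 : (x : ℤ) = k + 1
    · have ex := t2 x c2
      rw [if_neg c1, if_pos c2] at e
      have ey : (s k).1 x = if k.1 = 0 then -pt (k.1 + 1) k.2 else pt k.1 k.2.le := by
        split_ifs at e ⊢
        · exact t4 _ (by omega)
        · exact t1 _ (by omega)
      rw [ey, ex]
      clear j1 j2 j3 j4 t1 t2 t3 t4 e f ey inj
      split_ifs <;> omega
    · by_cases c3 : (x : ℤ) = -k
      · have ex := t3 x c3
        rw [if_neg c1, if_neg c2, if_pos c3] at e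
        have ey := t4 _ e
        rw [ey, ex]
        clear j1 j2 j3 j4 t1 t2 t3 t4 e f ey inj
        split_ifs <;> omega
      · by_cases c4 : (x : ℤ) = -(k + 1)
        · have ex := t4 x c4
          rw [if_neg c1, if_neg c2, if_neg c3, if_pos c4] at e
          have ey : (s k).1 x = if k.1 = 0 then pt (k.1 + 1) k.2 else -pt k.1 k.2.le := by
            split_ifs at e ⊢
            · exact t2 _ (by omega)
            · exact t3 _ (by omega)
          rw [ey, ex]
          clear j1 j2 j3 j4 t1 t2 t3 t4 e f ey inj
          split_ifs <;> omega
        · rw [if_neg c1, if_neg c2, if_neg c3, if_neg c4] at e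
          rw [Subtype.ext e]
          push_cast at *
          have hz' := inj x (pt 0 (Nat.zero_le d))
          rw [coe_pt] at hz'
          split_ifs <;> omega

theorem s_mul_eq_of_flip {d : ℕ} (u : W d) (j k : Fin d) (h : ¬ (Asc u k ↔ Asc (s j * u) k)) :
    s j * u = u * s k := by
  by_cases h1 : Asc u k
  · exact s_mul_eq_of_flip_aux u j k h1 (by tauto)
  · have h2 : Asc (s j * u) k := by tauto
    have e : s j * (s j * u) = u := by rw [← mul_assoc, s_mul_self, one_mul]
    have := s_mul_eq_of_flip_aux (s j * u) j k h2 (by rw [e]; exact h1)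
    rw [e] at this
    have h3 := congrArg (· * s k) this
    simp only [mul_assoc, s_mul_self, mul_one] at h3
    exact h3.symm

theorem exists_shorter {d : ℕ} (k : Fin d) (L : List (Fin d)) (h : ¬ Asc (L.map s).prod k) :
    ∃ M : List (Fin d), M.length + 1 = L.length ∧ (M.map s).prod = (L.map s).prod * s k := by
  induction L with
  | nil => exact absurd (asc_one k) h
  | cons a L ih =>
    by_cases hu : Asc (L.map s).prod k
    · refine ⟨L, rfl, ?_⟩
      rw [List.map_cons, List.prod_cons] at h ⊢
      rw [s_mul_eq_of_flip_aux _ _ _ hu h, mul_assoc, s_mul_self, mul_one]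
    · obtain ⟨M, hM, e⟩ := ih hu
      refine ⟨a :: M, by simp [hM], ?_⟩
      rw [List.map_cons, List.prod_cons, List.map_cons, List.prod_cons, e, mul_assoc]

theorem length_mul_s_of_not_asc {d : ℕ} (w : W d) (k : Fin d) (h : ¬ Asc w k) :
    length (w * s k) + 1 = length w := by
  obtain ⟨L, hL, rfl⟩ := exists_reduced w
  obtain ⟨M, hM, e⟩ := exists_shorter k L h
  have h1 := length_le M
  have h2 := length_mul_le ((L.map s).prod * s k) (s k)
  rw [mul_assoc, s_mul_self, mul_one] at h2
  have h3 := length_s_le k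
  rw [e] at h1
  omega

theorem length_mul_s_of_asc {d : ℕ} (w : W d) (k : Fin d) (h : Asc w k) :
    length (w * s k) = length w + 1 := by
  have := length_mul_s_of_not_asc (w * s k) k (by rw [asc_mul_s]; exact not_not.mpr h)
  rw [mul_assoc, s_mul_self, mul_one] at this
  exact this.symm

theorem lt_length_mul_s {d : ℕ} (w : W d) (k : Fin d) :
    length w < length (w * s k) ↔ Asc w k := by
  by_cases h : Asc w k
  · simp [h, length_mul_s_of_asc]
  · have := length_mul_s_of_not_asc w k h
    simp only [h, iff_false]; omega

theorem length_s_mul {d : ℕ} (w : W d) (k : Fin d) :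
    length (s k * w) = length (w⁻¹ * s k) := by
  rw [← length_inv, mul_inv_rev, s_inv]

theorem lt_length_s_mul {d : ℕ} (w : W d) (k : Fin d) :
    length w < length (s k * w) ↔ Asc w⁻¹ k := by
  rw [length_s_mul, ← lt_length_mul_s, length_inv]

/-- The Hecke algebra of `W` over `R` with parameter `q`: the free `R`-module with basis
`T w`, `w ∈ W`. The multiplication is defined below; see `T_mul_T` and `T_s_quadratic`. -/
def Hecke (R : Type*) [CommRing R] (_q : R) (d : ℕ) : Type _ := W d →₀ R

section Hecke

variable {R : Type*} [CommRing R] {q : R} {d : ℕ}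

noncomputable instance : AddCommGroup (Hecke R q d) := inferInstanceAs (AddCommGroup (W d →₀ R))

noncomputable instance : Module R (Hecke R q d) := inferInstanceAs (Module R (W d →₀ R))

/-- The basis `T w`, `w ∈ W`, of the Hecke algebra. -/
noncomputable def TBasis (R : Type*) [CommRing R] (q : R) (d : ℕ) :
    Module.Basis (W d) R (Hecke R q d) :=
  Module.Basis.ofRepr (LinearEquiv.refl R (W d →₀ R))

/-- The basis element `T w`. -/
noncomputable def T (R : Type*) [CommRing R] (q : R) {d : ℕ} (w : W d) : Hecke R q d :=
  TBasis R q d w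

open Classical in
/-- Left multiplication by `T s_k`. -/
noncomputable def leftOp (R : Type*) [CommRing R] (q : R) {d : ℕ} (k : Fin d) :
    Hecke R q d →ₗ[R] Hecke R q d :=
  (TBasis R q d).constr R fun w =>
    if length w < length (s k * w) then T R q (s k * w)
    else q • T R q (s k * w) + (q - 1) • T R q w

open Classical in
/-- Right multiplication by `T s_k`. -/
noncomputable def rightOp (R : Type*) [CommRing R] (q : R) {d : ℕ} (k : Fin d) :
    Hecke R q d →ₗ[R] Hecke R q d :=
  (TBasis R q d).constr R fun w =>
    if length w < length (w * s k) then T R q (w * s k)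
    else q • T R q (w * s k) + (q - 1) • T R q w

open Classical in
theorem leftOp_T (k : Fin d) (w : W d) : leftOp R q k (T R q w) =
    if length w < length (s k * w) then T R q (s k * w)
    else q • T R q (s k * w) + (q - 1) • T R q w :=
  Module.Basis.constr_basis _ _ _ _

open Classical in
theorem rightOp_T (k : Fin d) (w : W d) : rightOp R q k (T R q w) =
    if length w < length (w * s k) then T R q (w * s k)
    else q • T R q (w * s k) + (q - 1) • T R q w :=
  Module.Basis.constr_basis _ _ _ _

theorem leftOp_rightOp (j k : Fin d) (x : Hecke R q d) :
    leftOp R q j (rightOp R q k x) = rightOp R q k (leftOp R q j x) := by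
  suffices h : leftOp R q j ∘ₗ rightOp R q k = rightOp R q k ∘ₗ leftOp R q j from
    LinearMap.congr_fun h x
  refine (TBasis R q d).ext fun w => ?_
  change leftOp R q j (rightOp R q k (T R q w)) = rightOp R q k (leftOp R q j (T R q w))
  have ass : s j * (w * s k) = s j * w * s k := (mul_assoc _ _ _).symm
  by_cases e : s j * w = w * s k
  · have e1 : s j * (w * s k) = w := by rw [← e, ← mul_assoc, s_mul_self, one_mul]
    have e2 : s j * w * s k = w := by rw [e, mul_assoc, s_mul_self, mul_one]
    have hne : length (w * s k) ≠ length w := by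
      by_cases h : Asc w k
      · have := length_mul_s_of_asc w k h; omega
      · have := length_mul_s_of_not_asc w k h; omega
    rw [rightOp_T, leftOp_T, e]
    by_cases h : length w < length (w * s k)
    · rw [if_pos h, leftOp_T, rightOp_T, e1, if_neg (by omega), mul_assoc (G := W d) w, s_mul_self,
        mul_one, if_neg (by omega)]
    · rw [if_neg h]
      simp only [map_add, map_smul]
      rw [leftOp_T, rightOp_T, e1, if_pos (by omega), mul_assoc (G := W d) w, s_mul_self,
        mul_one, if_pos (by omega), leftOp_T, rightOp_T, e]
  · have h1 : length w < length (s j * w) ↔ length (w * s k) < length (s j * (w * s k)) := by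
      rw [lt_length_s_mul, lt_length_s_mul, mul_inv_rev, s_inv]
      by_contra h
      have := s_mul_eq_of_flip w⁻¹ k j h
      apply e
      have := congrArg (·⁻¹) this
      simp only [mul_inv_rev, s_inv, inv_inv] at this
      exact this.symm
    have h2 : length w < length (w * s k) ↔ length (s j * w) < length (s j * w * s k) := by
      rw [lt_length_mul_s, lt_length_mul_s]
      by_contra h
      exact e (s_mul_eq_of_flip w j k h)
    rw [rightOp_T, leftOp_T]
    by_cases c1 : length w < length (s j * w) <;> by_cases c2 : length w < length (w * s k)
    · rw [if_pos c1, if_pos c2, leftOp_T, rightOp_T, if_pos (h1.mp c1), if_pos (h2.mp c2), ass]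
    · rw [if_pos c1, if_neg c2]
      simp only [map_add, map_smul]
      rw [leftOp_T, leftOp_T, rightOp_T, if_pos (h1.mp c1), if_neg (fun h => c2 (h2.mpr h)), ass,
        if_pos c1]
    · rw [if_neg c1, if_pos c2]
      simp only [map_add, map_smul]
      rw [leftOp_T, rightOp_T, rightOp_T, if_neg (fun h => c1 (h1.mpr h)), if_pos (h2.mp c2), ass,
        if_pos c2]
    · rw [if_neg c1, if_neg c2]
      simp only [map_add, map_smul]
      rw [leftOp_T, leftOp_T, rightOp_T, rightOp_T, if_neg (fun h => c1 (h1.mpr h)),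
        if_neg (fun h => c2 (h2.mpr h)), if_neg c1, if_neg c2, ass]
      module

/-- Left multiplication by `T w`, as the product of the `leftOp` over a reduced word. -/
noncomputable def opT (R : Type*) [CommRing R] (q : R) {d : ℕ} (w : W d) :
    Module.End R (Hecke R q d) :=
  (((exists_reduced w).choose).map (leftOp R q)).prod

/-- Left multiplication of the Hecke algebra. -/
noncomputable def mulMap (R : Type*) [CommRing R] (q : R) (d : ℕ) :
    Hecke R q d →ₗ[R] Module.End R (Hecke R q d) :=
  (TBasis R q d).constr R (opT R q)

noncomputable instance : Mul (Hecke R q d) := ⟨fun a b => mulMap R q d a b⟩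

noncomputable instance : One (Hecke R q d) := ⟨T R q 1⟩

theorem mul_def (a b : Hecke R q d) : a * b = mulMap R q d a b := rfl

theorem one_def : (1 : Hecke R q d) = T R q 1 := rfl

theorem mulMap_T (w : W d) : mulMap R q d (T R q w) = opT R q w :=
  Module.Basis.constr_basis _ _ _ _

theorem word_T (L : List (Fin d)) (w : W d)
    (h : length ((L.map s).prod * w) = L.length + length w) :
    (L.map (leftOp R q)).prod (T R q w) = T R q ((L.map s).prod * w) := by
  induction L with
  | nil => simp
  | cons a L ih =>
    rw [List.map_cons, List.prod_cons, mul_assoc, List.length_cons] at h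
    have h1 := length_mul_le (s a) ((L.map s).prod * w)
    have h2 := length_mul_le (L.map s).prod w
    have h3 := length_le L
    have h4 := length_s_le a
    rw [List.map_cons, List.prod_cons, List.map_cons, List.prod_cons, mul_assoc]
    change leftOp R q a ((L.map (leftOp R q)).prod (T R q w)) = _
    rw [ih (by omega), leftOp_T, if_pos (by omega)]

theorem opT_T (u w : W d) (h : length (u * w) = length u + length w) :
    opT R q u (T R q w) = T R q (u * w) := by
  obtain ⟨h1, h2⟩ := (exists_reduced u).choose_spec
  unfold opT
  rw [word_T _ _ (by rw [h1, h2, h]), h2]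

theorem mulMap_one (a : Hecke R q d) : mulMap R q d a (T R q 1) = a := by
  suffices h : (mulMap R q d).flip (T R q 1) = LinearMap.id from LinearMap.congr_fun h a
  refine (TBasis R q d).ext fun w => ?_
  change mulMap R q d (T R q w) (T R q 1) = T R q w
  rw [mulMap_T, opT_T _ _ (by rw [mul_one, length_one, add_zero]), mul_one]

theorem mulMap_rightOp (a : Hecke R q d) (k : Fin d) (x : Hecke R q d) :
    mulMap R q d a (rightOp R q k x) = rightOp R q k (mulMap R q d a x) := by
  suffices h : (mulMap R q d).flip (rightOp R q k x) = rightOp R q k ∘ₗ (mulMap R q d).flip x from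
    LinearMap.congr_fun h a
  refine (TBasis R q d).ext fun w => ?_
  change mulMap R q d (T R q w) (rightOp R q k x) = rightOp R q k (mulMap R q d (T R q w) x)
  rw [mulMap_T]
  unfold opT
  generalize (exists_reduced w).choose = L
  induction L with
  | nil => rfl
  | cons a L ih =>
    rw [List.map_cons, List.prod_cons]
    change leftOp R q a ((L.map (leftOp R q)).prod (rightOp R q k x)) =
      rightOp R q k (leftOp R q a ((L.map (leftOp R q)).prod x))
    rw [ih, leftOp_rightOp]

/-- An operator that commutes with all `rightOp` is determined by its value at `T 1`. -/
theorem ext_of_rightOp (P Q : Module.End R (Hecke R q d))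
    (hP : ∀ k x, P (rightOp R q k x) = rightOp R q k (P x))
    (hQ : ∀ k x, Q (rightOp R q k x) = rightOp R q k (Q x))
    (h : P (T R q 1) = Q (T R q 1)) : P = Q := by
  refine (TBasis R q d).ext fun w => ?_
  change P (T R q w) = Q (T R q w)
  have key : ∀ n (w : W d), length w = n → P (T R q w) = Q (T R q w) := by
    intro n
    induction n with
    | zero =>
      intro w hw
      obtain ⟨L, hL, e⟩ := exists_reduced w
      rw [hw, List.length_eq_zero_iff] at hL
      rw [← e, hL]
      exact h
    | succ n ih =>
      intro w hw
      have : ∃ k, ¬ Asc w k := by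
        by_contra hc
        push Not at hc
        rw [eq_one_of_no_descent w fun k => (hc k).le, length_one] at hw
        omega
      obtain ⟨k, hk⟩ := this
      have h1 := length_mul_s_of_not_asc w k hk
      have h2 : rightOp R q k (T R q (w * s k)) = T R q w := by
        rw [rightOp_T, mul_assoc, s_mul_self, mul_one, if_pos (by omega)]
      rw [← h2, hP, hQ, ih _ (by omega)]
  exact key _ w rfl

theorem mulMap_mul (a b : Hecke R q d) :
    mulMap R q d (mulMap R q d a b) = mulMap R q d a * mulMap R q d b := by
  refine ext_of_rightOp _ _ (mulMap_rightOp _) (fun k x => ?_) ?_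
  · simp only [Module.End.mul_apply, mulMap_rightOp]
  · simp only [Module.End.mul_apply, mulMap_one]

theorem mulMap_T_one : mulMap R q d (T R q 1) = 1 :=
  ext_of_rightOp _ _ (mulMap_rightOp _) (fun _ _ => rfl) (by rw [mulMap_one]; rfl)

noncomputable instance : Ring (Hecke R q d) :=
  { (inferInstance : AddCommGroup (Hecke R q d)), (inferInstance : Mul (Hecke R q d)),
    (inferInstance : One (Hecke R q d)) with
    left_distrib := fun a b c => by simp only [mul_def, map_add]
    right_distrib := fun a b c => by simp only [mul_def, map_add, LinearMap.add_apply]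
    zero_mul := fun a => by simp only [mul_def, map_zero, LinearMap.zero_apply]
    mul_zero := fun a => by simp only [mul_def, map_zero]
    mul_assoc := fun a b c => by simp only [mul_def, mulMap_mul, Module.End.mul_apply]
    one_mul := fun a => by rw [mul_def, one_def, mulMap_T_one]; rfl
    mul_one := fun a => by rw [mul_def, one_def, mulMap_one] }

noncomputable instance : Algebra R (Hecke R q d) :=
  Algebra.ofModule (fun r a b => by simp only [mul_def, map_smul, LinearMap.smul_apply])
    (fun r a b => by simp only [mul_def, map_smul])

/-- `T_w T_w' = T_{ww'}` if `ℓ(ww') = ℓ(w) + ℓ(w')`. -/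
theorem T_mul_T (u w : W d) (h : length (u * w) = length u + length w) :
    T R q u * T R q w = T R q (u * w) := by
  rw [mul_def, mulMap_T, opT_T u w h]

/-- `(T_{s_k} + 1)(T_{s_k} - q) = 0`. -/
theorem T_s_quadratic (k : Fin d) :
    (T R q (s k) + 1) * (T R q (s k) - algebraMap R _ q) = 0 := by
  have l1 : length (s k) = 1 := by
    have := length_mul_s_of_asc (1 : W d) k (asc_one k)
    rwa [one_mul, length_one] at this
  have e : mulMap R q d (T R q (s k)) = leftOp R q k := by
    refine ext_of_rightOp _ _ (mulMap_rightOp _) (leftOp_rightOp k) ?_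
    rw [mulMap_one, leftOp_T, mul_one, length_one, if_pos (by omega)]
  have sq : T R q (s k) * T R q (s k) = q • (1 : Hecke R q d) + (q - 1) • T R q (s k) := by
    rw [mul_def, e, leftOp_T, s_mul_self, length_one, if_neg (by omega), one_def]
  rw [Algebra.algebraMap_eq_smul_one, add_mul, mul_sub, sq, one_mul, mul_smul_comm, mul_one]
  module

end Hecke

/-- The Laurent polynomial ring `ℤ[v, v⁻¹]`. -/
abbrev A : Type := LaurentPolynomial ℤ

/-- The unit `v` of `ℤ[v, v⁻¹]`. -/
noncomputable def v : Aˣ where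
  val := LaurentPolynomial.T 1
  inv := LaurentPolynomial.T (-1)
  val_inv := by rw [← LaurentPolynomial.T_add]; simp
  inv_val := by rw [← LaurentPolynomial.T_add]; simp

/-- `q = v²`. -/
noncomputable def q : Aˣ := v ^ 2

/-- The Hecke algebra of type `B_d` over `ℤ[v, v⁻¹]` with parameter `q = v²`. -/
abbrev H (d : ℕ) : Type := Hecke A (q : A) d

/-- Weak compositions `(λ_0, …, λ_m | λ_{m+1}, …, λ_{m+n})` of `d`. -/
abbrev Comp (m n d : ℕ) : Type := {lam : Fin (m + n + 1) → ℕ // ∑ i, lam i = d}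

/-- The partial sums `λ_0 + ⋯ + λ_r`. -/
def partialSum {m n d : ℕ} (lam : Comp m n d) (r : ℕ) : ℕ :=
  ∑ i : Fin (m + n + 1) with i.1 ≤ r, lam.1 i

/-- The condition `s_k ∈ S ∖ {s_{λ_0}, s_{λ_0+λ_1}, …, s_{λ_0+⋯+λ_{m+n-1}}}`. -/
def IsParabolicIndex {m n d : ℕ} (lam : Comp m n d) (k : Fin d) : Prop :=
  ∀ r < m + n, k.1 ≠ partialSum lam r

/-- The parabolic subgroup `W_λ`. -/
def parabolic {m n d : ℕ} (lam : Comp m n d) : Subgroup (W d) :=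
  Subgroup.closure {w | ∃ k : Fin d, IsParabolicIndex lam k ∧ w = s k}

/-- The even part of `W_λ`, generated by its simple reflections `s_k` with
`k < λ_0 + ⋯ + λ_m`. -/
def evenPart {m n d : ℕ} (lam : Comp m n d) : Subgroup (W d) :=
  Subgroup.closure {w | ∃ k : Fin d, IsParabolicIndex lam k ∧ k.1 < partialSum lam m ∧ w = s k}

/-- The odd part of `W_λ`, generated by its simple reflections `s_k` with
`k > λ_0 + ⋯ + λ_m`. -/
def oddPart {m n d : ℕ} (lam : Comp m n d) : Subgroup (W d) :=
  Subgroup.closure {w | ∃ k : Fin d, IsParabolicIndex lam k ∧ partialSum lam m < k.1 ∧ w = s k}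

/-- The shortest representatives of the right cosets `W_λ g`. -/
def shortestReps {m n d : ℕ} (lam : Comp m n d) : Set (W d) :=
  {g | ∀ x ∈ parabolic lam, length g ≤ length (x * g)}

/-- The sum of `T w` over the even part of `W_λ`. -/
noncomputable def xEven {m n d : ℕ} (lam : Comp m n d) : H d :=
  ∑ w ∈ (Set.toFinite (evenPart lam : Set (W d))).toFinset, T A (q : A) w

/-- The sum of `(-q)^{-ℓ(w)} T w` over the odd part of `W_λ`. -/
noncomputable def yOdd {m n d : ℕ} (lam : Comp m n d) : H d :=
  ∑ w ∈ (Set.toFinite (oddPart lam : Set (W d))).toFinset,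
    (((-q) ^ (-(length w : ℤ)) : Aˣ) : A) • T A (q : A) w

/-- The element `[xy]_λ`. -/
noncomputable def xy {m n d : ℕ} (lam : Comp m n d) : H d := xEven lam * yOdd lam

/-- The right ideal `[xy]_λ H` of `H`, as a right `H`-module. -/
noncomputable def xyIdeal {m n d : ℕ} (lam : Comp m n d) : Submodule (H d)ᵐᵒᵖ (H d) :=
  Submodule.span (H d)ᵐᵒᵖ {xy lam}

theorem xy_mul_mem {m n d : ℕ} (lam : Comp m n d) (h : H d) : xy lam * h ∈ xyIdeal lam :=
  (xyIdeal lam).smul_mem (MulOpposite.op h) (Submodule.mem_span_singleton_self (xy lam))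

theorem hecke_smul_op_smul {d : ℕ} (r : A) (a : (H d)ᵐᵒᵖ) (b : H d) :
    (r • a) • b = r • (a • b) := by
  change b * (r • a.unop) = r • (b * a.unop)
  exact mul_smul_comm r b a.unop

instance (d : ℕ) : IsScalarTower A (H d)ᵐᵒᵖ (H d) :=
  ⟨hecke_smul_op_smul⟩

/-- The parity of `i ∈ [-(m+n)..m+n]`: `0` if `|i| ≤ m`, and `1` otherwise. -/
def parity {m n : ℕ} (i : SymInterval (m + n)) : ℕ := if |(i : ℤ)| ≤ m then 0 else 1

/-- The extension of `(i_1, …, i_d)` to indices in `[-d..d]` by `i_0 = 0` and `i_{-j} = -i_j`. -/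
def extend {N d : ℕ} (i : Fin d → SymInterval N) (x : SymInterval d) : SymInterval N :=
  if h : 0 < (x : ℤ) then i ⟨((x : ℤ) - 1).toNat, by have := x.2.2; omega⟩
  else if h' : (x : ℤ) < 0 then -i ⟨(-(x : ℤ) - 1).toNat, by have := x.2.1; omega⟩
  else pt 0 (Nat.zero_le N)

/-- The right action of `W` on `d`-tuples by signed place permutations, `(i w)_j = i_{w(j)}`. -/
def act {N d : ℕ} (i : Fin d → SymInterval N) (w : W d) : Fin d → SymInterval N :=
  fun j => extend i (w.1 (pt (j.1 + 1) j.2))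

theorem extend_pos {N d : ℕ} (i : Fin d → SymInterval N) (j : Fin d) (x : SymInterval d)
    (h : (x : ℤ) = j + 1) : extend i x = i j := by
  unfold extend
  rw [dif_pos (by omega)]
  congr 1
  apply Fin.ext
  dsimp only
  omega

theorem extend_neg {N d : ℕ} (i : Fin d → SymInterval N) (x : SymInterval d) :
    extend i (-x) = -extend i x := by
  unfold extend
  simp only [coe_neg, neg_neg]
  rcases lt_trichotomy (x : ℤ) 0 with h | h | h
  · rw [dif_pos (by omega), dif_neg (by omega), dif_pos h]
    exact Subtype.ext (neg_neg _).symm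
  · rw [dif_neg (by omega), dif_neg (by omega), dif_neg (by omega), dif_neg (by omega)]
    apply Subtype.ext; rw [coe_neg, coe_pt]; rfl
  · rw [dif_neg (by omega), dif_pos (by omega), dif_pos h]

theorem act_one {N d : ℕ} (i : Fin d → SymInterval N) : act i 1 = i := by
  funext j
  exact extend_pos i j _ (by change ((pt (j.1 + 1) j.2 : SymInterval d) : ℤ) = _; rw [coe_pt]; simp)

theorem extend_act {N d : ℕ} (i : Fin d → SymInterval N) (u : W d) (x : SymInterval d) :
    extend (act i u) x = extend i (u.1 x) := by
  have key : ∀ x : SymInterval d, 0 < (x : ℤ) → extend (act i u) x = extend i (u.1 x) := by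
    intro x hx
    have hx2 := x.2.2
    rw [extend_pos (act i u) ⟨((x : ℤ) - 1).toNat, by omega⟩ x (by dsimp only; omega)]
    unfold act
    congr 2
    apply Subtype.ext
    rw [coe_pt]
    dsimp only
    omega
  rcases lt_trichotomy (x : ℤ) 0 with h | h | h
  · have e : x = - -x := Subtype.ext (by rw [coe_neg, coe_neg, neg_neg])
    have k := key (-x) (by rw [coe_neg]; omega)
    have e1 := extend_neg (act i u) (-x)
    have e2 := extend_neg i (u.1 (-x))
    rw [← W_neg, ← e] at e2
    rw [← e] at e1
    rw [e1, e2, k]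
  · have e : x = pt 0 (Nat.zero_le d) := Subtype.ext h
    subst e
    have e2 : u.1 (pt 0 (Nat.zero_le d)) = pt 0 (Nat.zero_le d) := Subtype.ext (coe_pt_zero u)
    rw [e2]
    unfold extend
    rfl
  · exact key x h

theorem act_mul {N d : ℕ} (i : Fin d → SymInterval N) (u w : W d) :
    act i (u * w) = act (act i u) w := by
  funext j
  exact (extend_act i u _).symm

theorem act_s_zero {N d : ℕ} (hd : 0 < d) (i : Fin d → SymInterval N) :
    act i (s ⟨0, hd⟩) = Function.update i ⟨0, hd⟩ (-i ⟨0, hd⟩) := by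
  funext j
  have e := coe_s ⟨0, hd⟩ (pt (j.1 + 1) j.2)
  rw [coe_pt] at e
  by_cases h : j = ⟨0, hd⟩
  · subst h
    rw [Function.update_self, ← extend_pos i ⟨0, hd⟩ (pt 1 hd) (by rw [coe_pt]; simp), ← extend_neg]
    unfold act
    congr 1
  · rw [Function.update_of_ne h]
    refine extend_pos i j _ ?_
    have hj : j.1 ≠ 0 := fun h' => h (Fin.ext h')
    rw [e]
    push_cast
    split_ifs <;> omega

theorem act_s_succ {N d : ℕ} (k : ℕ) (hk : k + 1 < d) (i : Fin d → SymInterval N) :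
    act i (s ⟨k + 1, hk⟩) = i ∘ Equiv.swap ⟨k, by omega⟩ ⟨k + 1, hk⟩ := by
  funext j
  have e := coe_s ⟨k + 1, hk⟩ (pt (j.1 + 1) j.2)
  rw [coe_pt] at e
  refine extend_pos i _ _ ?_
  rw [e, Equiv.swap_apply_def]
  simp only [Fin.ext_iff]
  push_cast
  split_ifs <;> (try dsimp only) <;> push_cast <;> omega

/-- The tuple `i_λ = (0, …, 0, 1, …, 1, …, m+n, …, m+n)` in which `r` occurs `λ_r` times:
its entry at the position `j` (counted from `0`) is the number of `r` with
`λ_0 + ⋯ + λ_r ≤ j`. -/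
def baseTuple {m n d : ℕ} (lam : Comp m n d) : Fin d → SymInterval (m + n) := fun j =>
  pt ((Finset.range (m + n)).filter fun r => partialSum lam r ≤ j.1).card
    (by simpa using Finset.card_filter_le (Finset.range (m + n)) fun r => partialSum lam r ≤ j.1)

/-- The parity in `{0, 1}` of a tuple. -/
def tupleParity {m n d : ℕ} (i : Fin d → SymInterval (m + n)) : ℕ :=
  ((∑ p : Fin d × Fin d with p.1 < p.2 ∧ (i p.1 : ℤ) > i p.2, parity (i p.1) * parity (i p.2)) +
    ∑ p : Fin d × Fin d with p.1 ≤ p.2 ∧ -(i p.1 : ℤ) > i p.2,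
      parity (i p.1) * parity (i p.2)) % 2

/-- The length `|i|` of a tuple. -/
def tupleLength {N d : ℕ} (i : Fin d → SymInterval N) : ℕ :=
  (Finset.univ.filter fun p : Fin d × Fin d => p.1 < p.2 ∧ (i p.1 : ℤ) > i p.2).card +
    (Finset.univ.filter fun p : Fin d × Fin d => p.1 ≤ p.2 ∧ -(i p.1 : ℤ) > i p.2).card

/-- The free module `V_{m|n}` with basis `e_i`, `i ∈ [-(m+n)..m+n]`. -/
abbrev V (m n : ℕ) : Type := SymInterval (m + n) →₀ A

/-- The tensor power `V_{m|n}^{⊗ d}` over `ℤ[v, v⁻¹]`. -/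
abbrev TensorV (m n d : ℕ) : Type := PiTensorProduct A fun _ : Fin d => V m n

/-- The normalized basis element `v^{|i|} e_{i_1} ⊗ ⋯ ⊗ e_{i_d}` of `V_{m|n}^{⊗ d}`. -/
noncomputable def eBold {m n d : ℕ} (i : Fin d → SymInterval (m + n)) : TensorV m n d :=
  (v : A) ^ tupleLength i • PiTensorProduct.tprod A fun k => Finsupp.single (i k) (1 : A)

/-- A right action of `H` on `V_{m|n}^{⊗ d}` is the signed action if `T_{s_0}, …, T_{s_{d-1}}`
act on the elements `eBold i` by the stated formulas. A tuple `(i_1, …, i_d)` is indexed by `Fin d`,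
so that its entry `i_{k+1}` is `i ⟨k, _⟩`. -/
structure IsSignedAction {m n d : ℕ}
    (act_H : (H d)ᵐᵒᵖ →ₐ[A] Module.End A (TensorV m n d)) : Prop where
  succ : ∀ (k : ℕ) (hk : k + 1 < d) (i : Fin d → SymInterval (m + n)) (a b : SymInterval (m + n)),
    a = i ⟨k, by omega⟩ → b = i ⟨k + 1, hk⟩ →
    act_H (MulOpposite.op (T A (q : A) (s ⟨k + 1, hk⟩))) (eBold i) =
      if (a : ℤ) < b then (-1 : A) ^ (parity a * parity b) • eBold (act i (s ⟨k + 1, hk⟩))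
      else if (a : ℤ) = b then ((-1 : A) ^ parity a * (q : A) ^ (1 - parity a)) • eBold i
      else ((-1 : A) ^ (parity a * parity b) * (q : A)) • eBold (act i (s ⟨k + 1, hk⟩)) +
        ((q : A) - 1) • eBold i
  zero : ∀ (hd : 0 < d) (i : Fin d → SymInterval (m + n)) (a : SymInterval (m + n)),
    a = i ⟨0, hd⟩ →
    act_H (MulOpposite.op (T A (q : A) (s ⟨0, hd⟩))) (eBold i) =
      if (a : ℤ) > 0 then (-1 : A) ^ parity a • eBold (act i (s ⟨0, hd⟩))
      else if (a : ℤ) = 0 then (q : A) • eBold i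
      else ((-1 : A) ^ parity a * (q : A)) • eBold (act i (s ⟨0, hd⟩)) + ((q : A) - 1) • eBold i

end TypeB

/-!
For `i ∈ [-(m+n)..m+n]^d` let `F` be the odd function on `[-d..d]` extending `i` by `i_0 = 0` and
`i_{-j} = -i_j`; the right action of `W` is then precomposition. The tuples `i_μ` are exactly those
for which `F` is weakly increasing and `i_1 ≥ 0`, and every orbit contains exactly one of them. The
parabolic subgroup `W_μ` is the stabilizer of `i_μ`, and `g` is a shortest representative of `W_μ g`
if and only if `g⁻¹` is increasing on the fibres of `F` for `i_μ`. So the Coxeter theory needed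
(additivity of lengths `Fixes.length_mul`, uniqueness `Fixes.eq_one_of_fibreMono`, and the behaviour
of representatives under right multiplication, `FibreMono.mul_s` and `FibreMono.exists_s_mul_eq`) is
proved for stabilizers of odd monotone functions on `[-d..d]`, and it gives the bijection between
tuples and pairs `(μ, g)`.

In the Hecke algebra, `[xy]_μ T_{s_j}` is `q [xy]_μ` or `-[xy]_μ` for `s_j` in the even or odd part
of `W_μ`. Hence the span of the `[xy]_μ T_g`, for shortest representatives `g`, is stable under the
generators: `g s_k` is either again a shortest representative or equal to `s_j g` with `s_j ∈ W_μ`.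
They are linearly independent because `[xy]_μ T_g` is `T_g` plus terms `T_w` with `w ∈ W_μ g`
different from `g` (`repr_xy_mul_T`). Thus they form a basis `xyBasis` of `[xy]_μ H`.

The map `(-1)^{parity of i} eBold i ↦ [xy]_μ T_g` is therefore a linear isomorphism, and the action
of `H` on the direct sum is transported along it. The transported action satisfies the required
formulas once the signs match, which is the count of odd inversions in `tupleSign_act_s_zero` and
`tupleSign_act_s_succ`. Since the `T_{s_k}` generate `H`, an action with these formulas is unique, so
every such action is the transported one and the isomorphism is `H`-linear for it.
-/

namespace TypeB

/-! ### Stabilizers of odd monotone functions -/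

/-- `F` is an odd weakly increasing function on `[-d..d]`. Such functions encode the standard
parabolic subgroups of `W d`: the stabilizer of `F` is generated by the `s k` with
`F k = F (k + 1)`. -/
structure IsOddMono {d : ℕ} (F : SymInterval d → ℤ) : Prop where
  odd : ∀ x, F (-x) = -F x
  mono : ∀ x y : SymInterval d, (x : ℤ) ≤ y → F x ≤ F y

/-- `F` takes the same value at `k` and `k + 1`. -/
def IsLevel {d : ℕ} (F : SymInterval d → ℤ) (k : Fin d) : Prop :=
  F (pt k.1 k.2.le) = F (pt (k.1 + 1) k.2)

/-- `w` stabilizes `F`, that is `F ∘ w = F`. -/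
def Fixes {d : ℕ} (F : SymInterval d → ℤ) (w : W d) : Prop := ∀ x, F (w.1 x) = F x

/-- `u` is strictly increasing on each fibre of `F`. -/
def FibreMono {d : ℕ} (F : SymInterval d → ℤ) (u : W d) : Prop :=
  ∀ x y : SymInterval d, (x : ℤ) < y → F x = F y → (u.1 x : ℤ) < u.1 y

theorem apply_inv_apply {d : ℕ} (w : W d) (x : SymInterval d) : w.1 ((w⁻¹ : W d).1 x) = x := by
  change (w * w⁻¹).1 x = x
  rw [mul_inv_cancel]; rfl

theorem inv_apply_apply {d : ℕ} (w : W d) (x : SymInterval d) : (w⁻¹ : W d).1 (w.1 x) = x := by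
  change (w⁻¹ * w).1 x = x
  rw [inv_mul_cancel]; rfl

theorem IsOddMono.zero {d : ℕ} {F : SymInterval d → ℤ} (hF : IsOddMono F) :
    F (pt 0 (Nat.zero_le d)) = 0 := by
  have h := hF.odd (pt 0 (Nat.zero_le d))
  have e : (-(pt 0 (Nat.zero_le d)) : SymInterval d) = pt 0 (Nat.zero_le d) :=
    Subtype.ext (by rw [coe_neg, coe_pt]; simp)
  rw [e] at h
  omega

theorem Fixes.inv {d : ℕ} {F : SymInterval d → ℤ} {w : W d} (h : Fixes F w) : Fixes F w⁻¹ := by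
  intro x
  rw [← h ((w⁻¹ : W d).1 x), apply_inv_apply]

theorem Fixes.mul {d : ℕ} {F : SymInterval d → ℤ} {u w : W d} (hu : Fixes F u) (hw : Fixes F w) :
    Fixes F (u * w) := fun x => (hu (w.1 x)).trans (hw x)

theorem fixes_one {d : ℕ} (F : SymInterval d → ℤ) : Fixes F 1 := fun _ => rfl

theorem fixes_s {d : ℕ} {F : SymInterval d → ℤ} (hF : IsOddMono F) {k : Fin d}
    (hk : IsLevel F k) : Fixes F (s k) := by
  intro x
  unfold IsLevel at hk
  have key : ∀ a b : SymInterval d, (a : ℤ) = b → F a = F b := fun a b h => by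
    rw [Subtype.ext h]
  have hz := hF.zero
  have h1 := hF.odd (pt k.1 k.2.le)
  have h2 := hF.odd (pt (k.1 + 1) k.2)
  have e := coe_s k x
  have p0 : ∀ a : SymInterval d, (a : ℤ) = 0 → F a = 0 := fun a h => by
    rw [key a _ (h.trans (coe_pt 0 (Nat.zero_le d)).symm), hz]
  have p1 : ∀ a : SymInterval d, (a : ℤ) = k → F a = F (pt k.1 k.2.le) := fun a h =>
    key _ _ (by rw [h, coe_pt])
  have p2 : ∀ a : SymInterval d, (a : ℤ) = k + 1 → F a = F (pt (k.1 + 1) k.2) := fun a h =>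
    key _ _ (by rw [h, coe_pt]; push_cast; rfl)
  have p3 : ∀ a : SymInterval d, (a : ℤ) = -k → F a = -F (pt k.1 k.2.le) := fun a h => by
    rw [← h1]; exact key _ _ (by rw [h, coe_neg, coe_pt])
  have p4 : ∀ a : SymInterval d, (a : ℤ) = -(k + 1) → F a = -F (pt (k.1 + 1) k.2) := fun a h => by
    rw [← h2]; exact key _ _ (by rw [h, coe_neg, coe_pt]; push_cast; rfl)
  have k0 : k.1 = 0 → F (pt k.1 k.2.le) = 0 := fun h => p0 _ (by rw [coe_pt, h]; rfl)
  split_ifs at e with c1 c2 c3 c4 c5 c6 c7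
  · rw [p0 _ e, p0 _ (by omega)]
  · rw [p1 _ c1, p2 _ e, hk]
  · rw [p2 _ c3, p4 _ (by omega)]; have := k0 c4; omega
  · rw [p2 _ c3, p1 _ e, hk]
  · rw [p3 _ c5, p4 _ e, hk]
  · rw [p4 _ c6, p2 _ (by omega)]; have := k0 c7; omega
  · rw [p4 _ c6, p3 _ e, hk]
  · exact key _ _ e

theorem exists_not_asc {d : ℕ} {w : W d} (hw : w ≠ 1) : ∃ k, ¬ Asc w k := by
  by_contra hc
  push Not at hc
  exact hw (eq_one_of_no_descent w fun k => (hc k).le)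

theorem Fixes.isLevel_of_not_asc {d : ℕ} {F : SymInterval d → ℤ} (hF : IsOddMono F) {w : W d}
    (hw : Fixes F w) {k : Fin d} (h : ¬ Asc w k) : IsLevel F k := by
  have h1 := hF.mono _ _ (not_asc h).le
  rw [hw, hw] at h1
  exact le_antisymm (hF.mono _ _ (by rw [coe_pt, coe_pt]; omega)) h1

theorem asc_inv_s_mul {d : ℕ} (x : W d) (k : Fin d) :
    Asc (s k * x)⁻¹ k ↔ ¬ Asc x⁻¹ k := by
  rw [mul_inv_rev, s_inv, asc_mul_s]

theorem s_mul_s_mul {d : ℕ} (k : Fin d) (x : W d) : s k * (s k * x) = x := by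
  rw [← mul_assoc, s_mul_self, one_mul]

theorem length_s_mul_of_asc {d : ℕ} {x : W d} {k : Fin d} (h : Asc x⁻¹ k) :
    length (s k * x) = length x + 1 := by
  rw [length_s_mul, length_mul_s_of_asc _ _ h, length_inv]

/-- Induction along left multiplication by simple reflections in the stabilizer of `F`: a left
descent `k` of an element of the stabilizer is automatically a level of `F`. -/
theorem Fixes.induction {d : ℕ} {F : SymInterval d → ℤ} (hF : IsOddMono F) {P : W d → Prop}
    (one : P 1)
    (step : ∀ k x, IsLevel F k → Fixes F x → Asc x⁻¹ k → P x → P (s k * x))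
    {x : W d} (hx : Fixes F x) : P x := by
  induction hn : length x generalizing x with
  | zero =>
    by_cases h1 : x = 1
    · rwa [h1]
    · obtain ⟨k, hk⟩ := exists_not_asc h1
      have := length_mul_s_of_not_asc x k hk
      omega
  | succ n ih =>
    have h1 : x ≠ 1 := by rintro rfl; rw [length_one] at hn; omega
    obtain ⟨k, hk⟩ := exists_not_asc (inv_ne_one.mpr h1)
    have hl := hx.inv.isLevel_of_not_asc hF hk
    have ha : Asc (s k * x)⁻¹ k := (asc_inv_s_mul x k).mpr hk
    have hx' : Fixes F (s k * x) := (fixes_s hF hl).mul hx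
    have h2 := length_s_mul_of_asc ha
    rw [s_mul_s_mul] at h2
    have := step k (s k * x) hl hx' ha (ih hx' (by omega))
    rwa [s_mul_s_mul] at this

/-- The stabilizer of `F` is the standard parabolic subgroup generated by the levels of `F`. -/
theorem mem_closure_iff_fixes {d : ℕ} {F : SymInterval d → ℤ} (hF : IsOddMono F) (x : W d) :
    x ∈ Subgroup.closure {w | ∃ k : Fin d, IsLevel F k ∧ w = s k} ↔ Fixes F x := by
  constructor
  · intro h
    induction h using Subgroup.closure_induction with
    | mem x h => obtain ⟨k, hk, rfl⟩ := h; exact fixes_s hF hk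
    | one => exact fixes_one F
    | mul x y _ _ hx hy => exact hx.mul hy
    | inv x _ hx => exact hx.inv
  · intro h
    refine h.induction hF (one_mem _) fun k x hk _ _ ih => mul_mem ?_ ih
    exact Subgroup.subset_closure ⟨k, hk, rfl⟩

/-- The fibres of `F` are intervals, so monotonicity on them can be checked on neighbours. -/
theorem fibreMono_iff {d : ℕ} {F : SymInterval d → ℤ} (hF : IsOddMono F) (u : W d) :
    FibreMono F u ↔ ∀ k, IsLevel F k → Asc u k := by
  refine ⟨fun h k hk => h _ _ (by rw [coe_pt, coe_pt]; omega) hk, fun h => ?_⟩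
  have consec : ∀ x y : SymInterval d, (y : ℤ) = x + 1 → F x = F y → (u.1 x : ℤ) < u.1 y := by
    intro x y hxy e
    have hx := x.2
    have hy := y.2
    rw [Set.mem_Icc] at hx hy
    rcases le_or_gt 0 (x : ℤ) with h0 | h0
    · have e1 : x = pt (x : ℤ).toNat (by omega) := Subtype.ext (by rw [coe_pt]; omega)
      have e2 : y = pt ((x : ℤ).toNat + 1) (by omega) :=
        Subtype.ext (by rw [coe_pt]; push_cast; omega)
      have := h ⟨(x : ℤ).toNat, by omega⟩ (by unfold IsLevel; dsimp only; rw [← e1, ← e2, e])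
      unfold Asc at this
      dsimp only at this
      rwa [← e1, ← e2] at this
    · have e1 : -y = pt (-(y : ℤ)).toNat (by omega) :=
        Subtype.ext (by rw [coe_pt, coe_neg]; omega)
      have e2 : -x = pt ((-(y : ℤ)).toNat + 1) (by omega) :=
        Subtype.ext (by rw [coe_pt, coe_neg]; push_cast; omega)
      have := h ⟨(-(y : ℤ)).toNat, by omega⟩
        (by unfold IsLevel; dsimp only; rw [← e1, ← e2, hF.odd, hF.odd, e])
      unfold Asc at this
      dsimp only at this
      rw [← e1, ← e2, W_neg, W_neg, coe_neg, coe_neg] at this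
      omega
  have main : ∀ (n : ℕ) (x y : SymInterval d), (y : ℤ) = x + (n + 1) → F x = F y →
      (u.1 x : ℤ) < u.1 y := by
    intro n
    induction n with
    | zero => intro x y hxy; exact consec x y (by omega)
    | succ n ih =>
      intro x y hxy e
      have hx := x.2
      have hy := y.2
      rw [Set.mem_Icc] at hx hy
      let z : SymInterval d := ⟨(y : ℤ) - 1, by rw [Set.mem_Icc]; omega⟩
      have hz : (z : ℤ) = y - 1 := rfl
      have h1 := hF.mono x z (by omega)
      have h2 := hF.mono z y (by omega)
      exact (ih x z (by omega) (by omega)).trans (consec z y (by omega) (by omega))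
  intro x y hxy e
  exact main ((y : ℤ) - x - 1).toNat x y (by omega) e

/-- Lengths add along a factorization into an element of the stabilizer and a representative
whose inverse is increasing on the fibres. -/
theorem Fixes.length_mul {d : ℕ} {F : SymInterval d → ℤ} (hF : IsOddMono F) {x g : W d}
    (hx : Fixes F x) (hg : FibreMono F g⁻¹) : length (x * g) = length x + length g := by
  refine hx.induction (P := fun x => length (x * g) = length x + length g) hF
    (by rw [one_mul, length_one, zero_add]) fun k x hk hx ha ih => ?_
  have : Asc (x * g)⁻¹ k := by
    rw [mul_inv_rev]
    exact hg _ _ ha (by rw [hx.inv, hx.inv]; exact hk)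
  rw [mul_assoc, length_s_mul_of_asc this, length_s_mul_of_asc ha, ih]
  omega

theorem eq_one_of_length_eq_zero {d : ℕ} {x : W d} (h : length x = 0) : x = 1 := by
  by_contra h1
  obtain ⟨k, hk⟩ := exists_not_asc h1
  have := length_mul_s_of_not_asc x k hk
  omega

/-- A coset of the stabilizer contains at most one representative whose inverse is increasing on
the fibres. -/
theorem Fixes.eq_one_of_fibreMono {d : ℕ} {F : SymInterval d → ℤ} (hF : IsOddMono F) {x g : W d}
    (hx : Fixes F x) (hg : FibreMono F g⁻¹) (hxg : FibreMono F (x * g)⁻¹) : x = 1 := by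
  have h1 := hx.length_mul hF hg
  have h2 := hx.inv.length_mul hF hxg
  rw [inv_mul_cancel_left] at h2
  exact eq_one_of_length_eq_zero (by omega)

theorem fibreMono_inv_iff_forall_length_le {d : ℕ} {F : SymInterval d → ℤ} (hF : IsOddMono F)
    (g : W d) : FibreMono F g⁻¹ ↔ ∀ x, Fixes F x → length g ≤ length (x * g) := by
  constructor
  · intro h x hx
    rw [hx.length_mul hF h]
    omega
  · intro h
    rw [fibreMono_iff hF]
    intro k hk
    rw [← lt_length_s_mul]
    refine lt_of_le_of_ne (h _ (fixes_s hF hk)) fun e => ?_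
    rw [length_s_mul] at e
    by_cases c : Asc g⁻¹ k
    · have := length_mul_s_of_asc _ _ c; rw [length_inv] at this; omega
    · have := length_mul_s_of_not_asc _ _ c; rw [length_inv] at this; omega

theorem exists_fibreMono {d : ℕ} {F : SymInterval d → ℤ} (hF : IsOddMono F) (g : W d) :
    ∃ x, Fixes F x ∧ FibreMono F (x * g)⁻¹ := by
  obtain ⟨x, hx, hmin⟩ := Set.exists_min_image {x : W d | Fixes F x} (fun x => length (x * g))
    (Set.toFinite _) ⟨1, fixes_one F⟩
  refine ⟨x, hx, (fibreMono_inv_iff_forall_length_le hF _).mpr fun y hy => ?_⟩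
  rw [← mul_assoc]
  exact hmin (y * x) (hy.mul hx)

/-- If `g` moves `k` and `k + 1` into different fibres, then with `g` also `g s_k` is a shortest
representative. -/
theorem FibreMono.mul_s {d : ℕ} {F : SymInterval d → ℤ} (hF : IsOddMono F) {g : W d}
    (hg : FibreMono F g⁻¹) {k : Fin d}
    (h : F (g.1 (pt k.1 k.2.le)) ≠ F (g.1 (pt (k.1 + 1) k.2))) :
    FibreMono F (g * s k)⁻¹ := by
  intro x y hxy e
  have h1 := hg x y hxy e
  rw [mul_inv_rev, s_inv]
  change (((s k).1 ((g⁻¹ : W d).1 x) : SymInterval d) : ℤ) < (s k).1 ((g⁻¹ : W d).1 y)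
  have hx := apply_inv_apply g x
  have hy := apply_inv_apply g y
  generalize (g⁻¹ : W d).1 x = a at *
  generalize (g⁻¹ : W d).1 y = b at *
  have hab : F (g.1 a) = F (g.1 b) := by rw [hx, hy, e]
  have key : ∀ c c' : SymInterval d, (c : ℤ) = c' → F (g.1 c) = F (g.1 c') := fun c c' hc => by
    rw [Subtype.ext hc]
  have o1 : F (g.1 (-pt k.1 k.2.le)) = -F (g.1 (pt k.1 k.2.le)) := by rw [W_neg, hF.odd]
  have o2 : F (g.1 (-pt (k.1 + 1) k.2)) = -F (g.1 (pt (k.1 + 1) k.2)) := by rw [W_neg, hF.odd]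
  have p1 : ∀ c : SymInterval d, (c : ℤ) = k → F (g.1 c) = F (g.1 (pt k.1 k.2.le)) := fun c hc =>
    key _ _ (by rw [hc, coe_pt])
  have p2 : ∀ c : SymInterval d, (c : ℤ) = k + 1 → F (g.1 c) = F (g.1 (pt (k.1 + 1) k.2)) :=
    fun c hc => key _ _ (by rw [hc, coe_pt]; push_cast; rfl)
  have p3 : ∀ c : SymInterval d, (c : ℤ) = -k → F (g.1 c) = -F (g.1 (pt k.1 k.2.le)) :=
    fun c hc => by rw [← o1]; exact key _ _ (by rw [hc, coe_neg, coe_pt])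
  have p4 : ∀ c : SymInterval d, (c : ℤ) = -(k + 1) → F (g.1 c) = -F (g.1 (pt (k.1 + 1) k.2)) :=
    fun c hc => by rw [← o2]; exact key _ _ (by rw [hc, coe_neg, coe_pt]; push_cast; rfl)
  have k0 : k.1 = 0 → F (g.1 (pt k.1 k.2.le)) = 0 := fun hk => by
    have : g.1 (pt k.1 k.2.le) = pt 0 (Nat.zero_le d) :=
      Subtype.ext (by simp only [hk]; exact coe_pt_zero g)
    rw [this, hF.zero]
  -- `s_k` reverses the order of `a < b` only for the pairs `(k, k+1)` and `(-k-1, -k)` and, if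
  -- `k = 0`, for `(-1, 1)`; none of these is moved into a single fibre.
  have n1 : ¬ ((a : ℤ) = k ∧ (b : ℤ) = k + 1) := fun ⟨ha, hb⟩ => h (by
    rw [← p1 a ha, ← p2 b hb, hab])
  have n2 : ¬ ((a : ℤ) = -(k + 1) ∧ (b : ℤ) = -k) := fun ⟨ha, hb⟩ => h (by
    rw [p4 a ha, p3 b hb] at hab; omega)
  have n3 : ¬ (k.1 = 0 ∧ (a : ℤ) = -(k + 1) ∧ (b : ℤ) = k + 1) := fun ⟨hk, ha, hb⟩ => h (by
    rw [p4 a ha, p2 b hb] at hab; have := k0 hk; omega)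
  have ea := coe_s k a
  have eb := coe_s k b
  clear p1 p2 p3 p4 key hab o1 o2 hg
  split_ifs at ea eb <;> omega

/-- If a shortest representative `g` moves `k` and `k + 1` into the same fibre, then `g` moves them
to neighbours, so that `g s_k = s_j g` for a level `j`. -/
theorem FibreMono.exists_s_mul_eq {d : ℕ} {F : SymInterval d → ℤ} (hF : IsOddMono F) {g : W d}
    (hg : FibreMono F g⁻¹) {k : Fin d}
    (h : F (g.1 (pt k.1 k.2.le)) = F (g.1 (pt (k.1 + 1) k.2))) :
    Asc g k ∧ ∃ j, IsLevel F j ∧ s j * g = g * s k ∧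
      |F (g.1 (pt k.1 k.2.le))| = |F (pt (j.1 + 1) j.2)| := by
  have hinv := inv_apply_apply g
  have hasc : Asc g k := by
    by_contra hc
    have := hg _ _ (not_asc hc) h.symm
    rw [hinv, hinv, coe_pt, coe_pt] at this
    omega
  refine ⟨hasc, ?_⟩
  have hlt := hasc
  unfold Asc at hlt
  set a := g.1 (pt k.1 k.2.le) with ha
  set b := g.1 (pt (k.1 + 1) k.2) with hb
  have a2 := a.2
  have b2 := b.2
  rw [Set.mem_Icc] at a2 b2
  have hadj : (b : ℤ) = a + 1 := by
    by_contra hne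
    let c : SymInterval d := ⟨(a : ℤ) + 1, by rw [Set.mem_Icc]; omega⟩
    have hc : (c : ℤ) = a + 1 := rfl
    have h1 := hF.mono a c (by omega)
    have h2 := hF.mono c b (by omega)
    have h3 := hg a c (by omega) (by omega)
    have h4 := hg c b (by omega) (by omega)
    rw [ha, hinv, coe_pt] at h3
    rw [hb, hinv, coe_pt] at h4
    omega
  rcases le_or_gt 0 (a : ℤ) with h0 | h0
  · have e1 : a = pt (a : ℤ).toNat (by omega) := Subtype.ext (by rw [coe_pt]; omega)
    have e2 : b = pt ((a : ℤ).toNat + 1) (by omega) :=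
      Subtype.ext (by rw [coe_pt]; push_cast; omega)
    refine ⟨⟨(a : ℤ).toNat, by omega⟩, ?_, ?_, ?_⟩
    · unfold IsLevel; dsimp only; rw [← e1, ← e2, h]
    · apply s_mul_eq_of_flip_aux _ _ _ hasc
      unfold Asc
      change ¬ (((s _).1 a : SymInterval d) : ℤ) < (s _).1 b
      rw [coe_s, coe_s]
      dsimp only
      split_ifs <;> omega
    · dsimp only; rw [← e2, h]
  · have e1 : -b = pt (-(b : ℤ)).toNat (by omega) :=
      Subtype.ext (by rw [coe_pt, coe_neg]; omega)
    have e2 : -a = pt ((-(b : ℤ)).toNat + 1) (by omega) :=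
      Subtype.ext (by rw [coe_pt, coe_neg]; push_cast; omega)
    refine ⟨⟨(-(b : ℤ)).toNat, by omega⟩, ?_, ?_, ?_⟩
    · unfold IsLevel; dsimp only; rw [← e1, ← e2, hF.odd, hF.odd, h]
    · apply s_mul_eq_of_flip_aux _ _ _ hasc
      unfold Asc
      change ¬ (((s _).1 a : SymInterval d) : ℤ) < (s _).1 b
      rw [coe_s, coe_s]
      dsimp only
      split_ifs <;> omega
    · dsimp only; rw [← e2, hF.odd, abs_neg]

/-- The odd step function on `[-d..d]` that jumps between `k` and `k + 1`, for `0 ≤ k`, exactly if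
`k` does not satisfy `J`. -/
noncomputable def stepFun {d : ℕ} (J : Fin d → Prop) (x : SymInterval d) : ℤ :=
  ({k : Fin d | ¬ J k ∧ (k.1 : ℤ) < x}.ncard : ℤ) - {k : Fin d | ¬ J k ∧ (k.1 : ℤ) < -x}.ncard

theorem isOddMono_stepFun {d : ℕ} (J : Fin d → Prop) : IsOddMono (stepFun J) where
  odd x := by
    unfold stepFun
    rw [coe_neg, neg_neg, neg_sub]
  mono x y h := by
    unfold stepFun
    have h1 := Set.ncard_le_ncard (s := {k : Fin d | ¬ J k ∧ (k.1 : ℤ) < x})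
      (t := {k : Fin d | ¬ J k ∧ (k.1 : ℤ) < y}) (fun k hk => ⟨hk.1, hk.2.trans_le h⟩)
    have h2 := Set.ncard_le_ncard (s := {k : Fin d | ¬ J k ∧ (k.1 : ℤ) < -y})
      (t := {k : Fin d | ¬ J k ∧ (k.1 : ℤ) < -x}) (fun k hk => ⟨hk.1, by have := hk.2; omega⟩)
    omega

/-- Every set of simple reflections is the set of levels of an odd monotone function. -/
theorem isLevel_stepFun {d : ℕ} (J : Fin d → Prop) (k : Fin d) : IsLevel (stepFun J) k ↔ J k := by
  unfold IsLevel stepFun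
  have e : ∀ j (hj : j ≤ d), {i : Fin d | ¬ J i ∧ (i.1 : ℤ) < -(pt j hj : SymInterval d)} = ∅ := by
    intro j hj
    ext i
    refine iff_of_false (fun h => ?_) (Set.notMem_empty i)
    have := h.2
    rw [coe_pt] at this
    omega
  rw [e, e]
  simp only [coe_pt, Set.ncard_empty, Nat.cast_zero, sub_zero, Nat.cast_inj]
  constructor
  · intro h
    by_contra hJ
    have hlt : {i : Fin d | ¬ J i ∧ (i.1 : ℤ) < k.1}.ncard <
        {i : Fin d | ¬ J i ∧ (i.1 : ℤ) < (k.1 + 1 : ℕ)}.ncard := by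
      refine Set.ncard_lt_ncard ⟨fun i hi => ⟨hi.1, by have := hi.2; omega⟩, fun hs => ?_⟩
      have := (hs (show k ∈ _ from ⟨hJ, by omega⟩)).2
      omega
    omega
  · intro hJ
    congr 1
    ext i
    constructor
    · rintro ⟨h1, h2⟩; exact ⟨h1, by omega⟩
    · rintro ⟨h1, h2⟩
      refine ⟨h1, ?_⟩
      have : i ≠ k := fun h => h1 (h ▸ hJ)
      have : i.1 ≠ k.1 := fun h => this (Fin.ext h)
      omega

theorem mem_closure_iff_fixes_stepFun {d : ℕ} (J : Fin d → Prop) (x : W d) :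
    x ∈ Subgroup.closure {w | ∃ k : Fin d, J k ∧ w = s k} ↔ Fixes (stepFun J) x := by
  simp only [← mem_closure_iff_fixes (isOddMono_stepFun J), isLevel_stepFun]

/-! ### The orbits of tuples -/

/-- The function on `[-d..d]` extending the tuple `i`, with integer values. -/
def profile {N d : ℕ} (i : Fin d → SymInterval N) (x : SymInterval d) : ℤ := extend i x

theorem profile_neg {N d : ℕ} (i : Fin d → SymInterval N) (x : SymInterval d) :
    profile i (-x) = -profile i x := by
  unfold profile
  rw [extend_neg, coe_neg]

theorem profile_succ {N d : ℕ} (i : Fin d → SymInterval N) (j : Fin d) :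
    profile i (pt (j.1 + 1) j.2) = i j := by
  unfold profile
  rw [extend_pos i j _ (by rw [coe_pt]; push_cast; rfl)]

theorem profile_act {N d : ℕ} (i : Fin d → SymInterval N) (w : W d) (x : SymInterval d) :
    profile (act i w) x = profile i (w.1 x) := by
  unfold profile
  rw [extend_act]

theorem profile_zero {N d : ℕ} (i : Fin d → SymInterval N) :
    profile i (pt 0 (Nat.zero_le d)) = 0 := by
  unfold profile extend
  rw [dif_neg (by rw [coe_pt]; omega), dif_neg (by rw [coe_pt]; omega), coe_pt]
  rfl

theorem profile_injective {N d : ℕ} {i j : Fin d → SymInterval N} (h : profile i = profile j) :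
    i = j := by
  funext k
  apply Subtype.ext
  rw [← profile_succ, ← profile_succ, h]

theorem act_eq_self_iff {N d : ℕ} (i : Fin d → SymInterval N) (w : W d) :
    act i w = i ↔ Fixes (profile i) w := by
  constructor
  · intro h x
    rw [← profile_act, h]
  · intro h
    apply profile_injective
    funext x
    rw [profile_act, h x]

/-- A tuple with `0 ≤ i_1 ≤ i_2 ≤ ⋯`. -/
def Dominant {N d : ℕ} (i : Fin d → SymInterval N) : Prop :=
  (∀ j, 0 ≤ (i j : ℤ)) ∧ ∀ j k, j ≤ k → (i j : ℤ) ≤ i k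

theorem Dominant.isOddMono {N d : ℕ} {i : Fin d → SymInterval N} (h : Dominant i) :
    IsOddMono (profile i) where
  odd := profile_neg i
  mono := by
    have zero : ∀ x : SymInterval d, (x : ℤ) = 0 → profile i x = 0 := fun x hx => by
      rw [Subtype.ext (hx.trans (coe_pt 0 (Nat.zero_le d)).symm : (x : ℤ) = _), profile_zero]
    have pos : ∀ x : SymInterval d, 0 < (x : ℤ) →
        ∃ j : Fin d, (j.1 : ℤ) + 1 = x ∧ profile i x = i j := fun x hx => by
      have := x.2.2
      refine ⟨⟨((x : ℤ) - 1).toNat, by omega⟩, by dsimp only; omega, ?_⟩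
      rw [← profile_succ]
      congr 1
      exact Subtype.ext (by rw [coe_pt]; dsimp only; omega)
    have nonneg : ∀ x : SymInterval d, 0 ≤ (x : ℤ) → 0 ≤ profile i x := fun x hx => by
      rcases hx.eq_or_lt with h0 | h0
      · rw [zero x h0.symm]
      · obtain ⟨j, -, e⟩ := pos x h0
        rw [e]; exact h.1 j
    have main : ∀ x y : SymInterval d, 0 ≤ (x : ℤ) → (x : ℤ) ≤ y → profile i x ≤ profile i y := by
      intro x y hx hxy
      rcases hx.eq_or_lt with h0 | h0
      · rw [zero x h0.symm]; exact nonneg y (by omega)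
      · obtain ⟨j, ej, e⟩ := pos x h0
        obtain ⟨k, ek, f⟩ := pos y (by omega)
        rw [e, f]
        exact h.2 j k (by rw [Fin.le_def]; omega)
    intro x y hxy
    rcases le_or_gt 0 (x : ℤ) with h1 | h1
    · exact main x y h1 hxy
    · have hx := profile_neg i x
      have hy := profile_neg i y
      rcases le_or_gt 0 (y : ℤ) with h2 | h2
      · have a := nonneg y h2
        have b := nonneg (-x) (by rw [coe_neg]; omega)
        omega
      · have := main (-y) (-x) (by rw [coe_neg]; omega) (by rw [coe_neg, coe_neg]; omega)
        omega

/-- Swapping a descent, or making a negative first entry positive, increases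
`∑ j, j * i_j`, so that a maximum of this sum over a `W`-orbit is dominant. -/
theorem exists_act_dominant {N d : ℕ} (i : Fin d → SymInterval N) : ∃ w, Dominant (act i w) := by
  obtain ⟨w, -, hw⟩ := Set.exists_max_image (Set.univ : Set (W d))
    (fun w => ∑ j : Fin d, ((j.1 : ℤ) + 1) * (act i w j : ℤ)) (Set.toFinite _) ⟨1, trivial⟩
  refine ⟨w, ?_⟩
  have hw' : ∀ k, ∑ j : Fin d, ((j.1 : ℤ) + 1) * (act (act i w) (s k) j : ℤ) ≤
      ∑ j : Fin d, ((j.1 : ℤ) + 1) * (act i w j : ℤ) := fun k => by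
    rw [← act_mul]; exact hw (w * s k) trivial
  generalize act i w = i' at *
  clear hw w i
  have hstep : ∀ k (hk : k + 1 < d), (i' ⟨k, by omega⟩ : ℤ) ≤ i' ⟨k + 1, hk⟩ := by
    intro k hk
    have h := hw' ⟨k + 1, hk⟩
    rw [act_s_succ k hk, ← Equiv.sum_comp (Equiv.swap (⟨k, by omega⟩ : Fin d) ⟨k + 1, hk⟩),
      ← sub_nonpos, ← Finset.sum_sub_distrib] at h
    have e : ∀ j : Fin d, (((Equiv.swap (⟨k, by omega⟩ : Fin d) ⟨k + 1, hk⟩ j).1 : ℤ) + 1) *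
        ((i' ∘ Equiv.swap (⟨k, by omega⟩ : Fin d) ⟨k + 1, hk⟩)
          (Equiv.swap (⟨k, by omega⟩ : Fin d) ⟨k + 1, hk⟩ j) : ℤ) - ((j.1 : ℤ) + 1) * (i' j : ℤ) =
        (if j = ⟨k, by omega⟩ then (i' j : ℤ) else 0) -
          (if j = ⟨k + 1, hk⟩ then (i' j : ℤ) else 0) := by
      intro j
      rw [Function.comp_apply, Equiv.swap_apply_self, Equiv.swap_apply_def]
      by_cases h1 : j = ⟨k, by omega⟩
      · subst h1
        rw [if_pos rfl, if_pos rfl, if_neg (by simp)]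
        push_cast; ring
      · rw [if_neg h1, if_neg h1]
        by_cases h2 : j = ⟨k + 1, hk⟩
        · subst h2
          rw [if_pos rfl, if_pos rfl]
          push_cast; ring
        · rw [if_neg h2, if_neg h2]
          ring
    rw [Finset.sum_congr rfl fun j _ => e j, Finset.sum_sub_distrib, Finset.sum_ite_eq',
      Finset.sum_ite_eq', if_pos (Finset.mem_univ _), if_pos (Finset.mem_univ _)] at h
    omega
  have hzero : ∀ hd : 0 < d, 0 ≤ (i' ⟨0, hd⟩ : ℤ) := by
    intro hd
    have h := hw' ⟨0, hd⟩
    rw [act_s_zero hd, ← sub_nonpos, ← Finset.sum_sub_distrib] at h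
    have e : ∀ j : Fin d, ((j.1 : ℤ) + 1) * (Function.update i' ⟨0, hd⟩ (-i' ⟨0, hd⟩) j : ℤ) -
        ((j.1 : ℤ) + 1) * (i' j : ℤ) = if j = ⟨0, hd⟩ then -2 * (i' j : ℤ) else 0 := by
      intro j
      by_cases h1 : j = ⟨0, hd⟩
      · subst h1
        rw [Function.update_self, if_pos rfl, coe_neg]
        push_cast; ring
      · rw [Function.update_of_ne h1, if_neg h1, sub_self]
    rw [Finset.sum_congr rfl fun j _ => e j, Finset.sum_ite_eq', if_pos (Finset.mem_univ _)] at h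
    omega
  have hmono : ∀ (t k : ℕ) (hk : k + t < d), (i' ⟨k, by omega⟩ : ℤ) ≤ i' ⟨k + t, hk⟩ := by
    intro t
    induction t with
    | zero => intro k hk; exact le_rfl
    | succ t ih => intro k hk; exact (ih k (by omega)).trans (hstep (k + t) hk)
  have hmono' : ∀ j k : Fin d, j ≤ k → (i' j : ℤ) ≤ i' k := by
    intro j k hjk
    rw [Fin.le_def] at hjk
    have := hmono (k.1 - j.1) j.1 (by omega)
    have e : (⟨j.1 + (k.1 - j.1), by omega⟩ : Fin d) = k := Fin.ext (by dsimp only; omega)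
    rwa [e] at this
  refine ⟨fun j => ?_, hmono'⟩
  have hd : 0 < d := j.pos
  exact (hzero hd).trans (hmono' ⟨0, hd⟩ j (by rw [Fin.le_def]; exact Nat.zero_le _))

/-- Two monotone rearrangements of the same values agree. -/
theorem IsOddMono.eq_of_comp {d : ℕ} {F G : SymInterval d → ℤ} (hF : IsOddMono F)
    (hG : IsOddMono G) (u : Equiv.Perm (SymInterval d)) (h : ∀ x, F (u x) = G x) : F = G := by
  have card : ∀ c : ℤ, (Finset.univ.filter fun x => c < F x).card =
      (Finset.univ.filter fun x => c < G x).card := by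
    intro c
    refine (Finset.card_bij (fun x _ => u x) ?_ ?_ ?_).symm
    · intro x hx
      simp only [Finset.mem_filter, Finset.mem_univ, true_and] at hx ⊢
      rwa [h]
    · intro x _ y _ e; exact u.injective e
    · intro y hy
      simp only [Finset.mem_filter, Finset.mem_univ, true_and] at hy
      refine ⟨u.symm y, ?_, u.apply_symm_apply y⟩
      simp only [Finset.mem_filter, Finset.mem_univ, true_and]
      rwa [← h, u.apply_symm_apply]
  have key : ∀ P Q : SymInterval d → ℤ, IsOddMono P → IsOddMono Q →
      (∀ c : ℤ, (Finset.univ.filter fun x => c < P x).card =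
        (Finset.univ.filter fun x => c < Q x).card) → ∀ x, P x ≤ Q x := by
    intro P Q hP hQ hc x
    by_contra hlt
    -- Compare the numbers of points with values above `Q x`: these upper sets are intervals, and only
    -- that of `P` contains `x`.
    have hss : (Finset.univ.filter fun y => Q x < Q y) ⊂ Finset.univ.filter fun y => Q x < P y := by
      rw [Finset.ssubset_iff_of_subset]
      · exact ⟨x, by simpa using hlt, by simp⟩
      · intro y hy
        simp only [Finset.mem_filter, Finset.mem_univ, true_and] at hy ⊢
        have hxy : (x : ℤ) ≤ y := by
          by_contra hn
          have := hQ.mono y x (by omega)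
          omega
        have := hP.mono x y hxy
        omega
    have := Finset.card_lt_card hss
    rw [hc] at this
    exact lt_irrefl _ this
  funext x
  exact le_antisymm (key F G hF hG card x) (key G F hG hF (fun c => (card c).symm) x)

section Comp

variable {m n d : ℕ} (mu : Comp m n d)

theorem partialSum_mono {r t : ℕ} (h : r ≤ t) : partialSum mu r ≤ partialSum mu t := by
  unfold partialSum
  refine Finset.sum_le_sum_of_subset fun i hi => ?_
  simp only [Finset.mem_filter, Finset.mem_univ, true_and] at hi ⊢
  omega

theorem partialSum_le (r : ℕ) : partialSum mu r ≤ d := by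
  unfold partialSum
  conv_rhs => rw [← mu.2]
  exact Finset.sum_le_sum_of_subset (Finset.filter_subset _ _)

theorem partialSum_last : partialSum mu (m + n) = d := by
  unfold partialSum
  conv_rhs => rw [← mu.2]
  rw [Finset.filter_true_of_mem]
  intro i _
  have := i.2
  omega

theorem partialSum_eq_add (r : ℕ) (hr : r + 1 < m + n + 1) :
    partialSum mu (r + 1) = partialSum mu r + mu.1 ⟨r + 1, hr⟩ := by
  unfold partialSum
  have : (Finset.univ.filter fun i : Fin (m + n + 1) => i.1 ≤ r + 1) =
      insert ⟨r + 1, hr⟩ (Finset.univ.filter fun i : Fin (m + n + 1) => i.1 ≤ r) := by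
    ext i
    simp only [Finset.mem_filter, Finset.mem_univ, true_and, Finset.mem_insert, Fin.ext_iff]
    omega
  rw [this, Finset.sum_insert (by simp), add_comm]

theorem partialSum_zero : partialSum mu 0 = mu.1 ⟨0, by omega⟩ := by
  unfold partialSum
  have : (Finset.univ.filter fun i : Fin (m + n + 1) => i.1 ≤ 0) = {⟨0, by omega⟩} := by
    ext i
    simp only [Finset.mem_filter, Finset.mem_univ, true_and, Finset.mem_singleton, Fin.ext_iff]
    omega
  rw [this, Finset.sum_singleton]

theorem lt_baseTuple_iff {r : ℕ} (hr : r < m + n) (j : Fin d) :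
    (r : ℤ) < baseTuple mu j ↔ partialSum mu r ≤ j.1 := by
  unfold baseTuple
  rw [coe_pt, Nat.cast_lt]
  constructor
  · intro h
    by_contra hn
    have : ((Finset.range (m + n)).filter fun r => partialSum mu r ≤ j.1) ⊆ Finset.range r := by
      intro t ht
      rw [Finset.mem_filter] at ht
      rw [Finset.mem_range]
      by_contra htr
      have := partialSum_mono mu (not_lt.mp htr)
      omega
    have := Finset.card_le_card this
    rw [Finset.card_range] at this
    omega
  · intro h
    have : Finset.range (r + 1) ⊆ (Finset.range (m + n)).filter fun r => partialSum mu r ≤ j.1 := by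
      intro t ht
      rw [Finset.mem_range] at ht
      rw [Finset.mem_filter, Finset.mem_range]
      have := partialSum_mono mu (show t ≤ r by omega)
      exact ⟨by omega, by omega⟩
    have := Finset.card_le_card this
    rw [Finset.card_range] at this
    omega

theorem baseTuple_nonneg (j : Fin d) : 0 ≤ (baseTuple mu j : ℤ) := by
  unfold baseTuple
  rw [coe_pt]
  omega

theorem dominant_baseTuple : Dominant (baseTuple mu) := by
  refine ⟨baseTuple_nonneg mu, fun j k hjk => ?_⟩
  by_contra hn
  have h1 := baseTuple_nonneg mu k
  have h2 := (baseTuple mu j).2.2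
  push_cast at h2
  have e : (((baseTuple mu k : ℤ).toNat : ℕ) : ℤ) = baseTuple mu k := by omega
  have h3 := (lt_baseTuple_iff mu (r := (baseTuple mu k : ℤ).toNat) (by omega) j).mp (by omega)
  have h4 := (lt_baseTuple_iff mu (r := (baseTuple mu k : ℤ).toNat) (by omega) k).mpr
    (h3.trans hjk)
  omega

theorem isOddMono_baseTuple : IsOddMono (profile (baseTuple mu)) :=
  (dominant_baseTuple mu).isOddMono

variable {mu} in
theorem baseTuple_injective {nu : Comp m n d} (h : baseTuple mu = baseTuple nu) : mu = nu := by
  have hP : ∀ r ≤ m + n, partialSum mu r = partialSum nu r := by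
    intro r hr
    rcases hr.eq_or_lt with rfl | hr
    · rw [partialSum_last, partialSum_last]
    have key : ∀ k < d, partialSum mu r ≤ k ↔ partialSum nu r ≤ k := fun k hk => by
      rw [← lt_baseTuple_iff mu hr ⟨k, hk⟩, ← lt_baseTuple_iff nu hr ⟨k, hk⟩, h]
    have h1 := partialSum_le mu r
    have h2 := partialSum_le nu r
    have k1 := key (partialSum mu r)
    have k2 := key (partialSum nu r)
    omega
  apply Subtype.ext
  funext ⟨r, hr⟩
  cases r with
  | zero => rw [← partialSum_zero, ← partialSum_zero, hP 0 (by omega)]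
  | succ r =>
    have e1 := partialSum_eq_add mu r hr
    have e2 := partialSum_eq_add nu r hr
    have := hP (r + 1) (by omega)
    have := hP r (by omega)
    omega

/-- A dominant tuple is `i_μ` for the composition `μ` counting the multiplicities of its entries. -/
theorem exists_baseTuple_eq {i : Fin d → SymInterval (m + n)} (hi : Dominant i) :
    ∃ mu : Comp m n d, baseTuple mu = i := by
  have hub : ∀ j, (i j : ℤ) ≤ m + n := fun j => by have := (i j).2.2; push_cast at this; exact this
  let f : Fin d → Fin (m + n + 1) := fun j =>
    ⟨(i j : ℤ).toNat, by have := hub j; have := hi.1 j; omega⟩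
  have hf : ∀ j, ((f j).1 : ℤ) = i j := fun j => by
    have := hi.1 j; change (((i j : ℤ).toNat : ℕ) : ℤ) = _; omega
  let mu : Comp m n d := ⟨fun r => (Finset.univ.filter fun j => f j = r).card, by
    rw [← Finset.card_eq_sum_card_fiberwise fun j _ => Finset.mem_univ (f j), Finset.card_univ,
      Fintype.card_fin]⟩
  have hP : ∀ r, partialSum mu r = (Finset.univ.filter fun j => (f j).1 ≤ r).card := by
    intro r
    unfold partialSum
    rw [Finset.card_eq_sum_card_fiberwise (f := f)
      (t := Finset.univ.filter fun t : Fin (m + n + 1) => t.1 ≤ r) (fun j hj => by simpa using hj)]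
    refine Finset.sum_congr rfl fun t ht => ?_
    simp only [Finset.mem_filter, Finset.mem_univ, true_and] at ht
    change (Finset.univ.filter fun j => f j = t).card = _
    congr 1
    ext j
    simp only [Finset.mem_filter, Finset.mem_univ, true_and]
    constructor
    · rintro rfl; exact ⟨ht, rfl⟩
    · exact fun h => h.2
  have hiff : ∀ r (j : Fin d), partialSum mu r ≤ j.1 ↔ r < (f j).1 := by
    intro r j
    rw [hP]
    constructor
    · intro h
      by_contra hn
      have hs : Finset.Iic j ⊆ Finset.univ.filter fun j => (f j).1 ≤ r := by
        intro k hk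
        rw [Finset.mem_Iic] at hk
        simp only [Finset.mem_filter, Finset.mem_univ, true_and]
        have := hi.2 k j hk
        have := hf k
        have := hf j
        omega
      have := Finset.card_le_card hs
      rw [Fin.card_Iic] at this
      omega
    · intro h
      have hs : (Finset.univ.filter fun j => (f j).1 ≤ r) ⊆ Finset.Iio j := by
        intro k hk
        simp only [Finset.mem_filter, Finset.mem_univ, true_and] at hk
        rw [Finset.mem_Iio]
        by_contra hn
        have := hi.2 j k (not_lt.mp hn)
        have := hf k
        have := hf j
        omega
      have := Finset.card_le_card hs
      rwa [Fin.card_Iio] at this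
  refine ⟨mu, ?_⟩
  funext j
  apply Subtype.ext
  unfold baseTuple
  rw [coe_pt, ← hf]
  congr 1
  have : ((Finset.range (m + n)).filter fun r => partialSum mu r ≤ j.1) = Finset.range (f j).1 := by
    ext r
    have := (f j).2
    rw [Finset.mem_filter, Finset.mem_range, Finset.mem_range, hiff]
    omega
  rw [this, Finset.card_range]

/-- `W_μ` is the standard parabolic subgroup attached to the levels of `i_μ`, that is, its
stabilizer. -/
theorem isLevel_baseTuple (k : Fin d) :
    IsLevel (profile (baseTuple mu)) k ↔ IsParabolicIndex mu k := by
  have hle : profile (baseTuple mu) (pt k.1 k.2.le) ≤ profile (baseTuple mu) (pt (k.1 + 1) k.2) :=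
    (isOddMono_baseTuple mu).mono _ _ (by rw [coe_pt, coe_pt]; omega)
  have lt_iff : ∀ r < m + n, (r : ℤ) < profile (baseTuple mu) (pt k.1 k.2.le) ↔
      partialSum mu r < k.1 := by
    intro r hr
    obtain ⟨k, hk⟩ := k
    dsimp only
    cases k with
    | zero => rw [profile_zero]; omega
    | succ k =>
      rw [profile_succ _ ⟨k, by omega⟩, lt_baseTuple_iff mu hr]
      dsimp only
      omega
  have lt_iff' : ∀ r < m + n, (r : ℤ) < profile (baseTuple mu) (pt (k.1 + 1) k.2) ↔
      partialSum mu r ≤ k.1 := by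
    intro r hr
    rw [profile_succ, lt_baseTuple_iff mu hr]
  unfold IsLevel IsParabolicIndex
  constructor
  · intro h r hr hk
    have h1 := lt_iff r hr
    have h2 := lt_iff' r hr
    rw [h] at h1
    omega
  · intro h
    by_contra hne
    have h0 : 0 ≤ profile (baseTuple mu) (pt k.1 k.2.le) := by
      have := (isOddMono_baseTuple mu).mono (pt 0 (Nat.zero_le d)) (pt k.1 k.2.le)
        (by rw [coe_pt, coe_pt]; omega)
      rwa [profile_zero] at this
    have hub : profile (baseTuple mu) (pt (k.1 + 1) k.2) ≤ m + n := by
      rw [profile_succ]; have := (baseTuple mu k).2.2; push_cast at this; exact this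
    obtain ⟨r, hr⟩ := Int.eq_ofNat_of_zero_le h0
    have hr' : r < m + n := by omega
    have h1 := lt_iff r hr'
    have h2 := lt_iff' r hr'
    have := h r hr'
    omega

theorem mem_parabolic_iff (x : W d) : x ∈ parabolic mu ↔ Fixes (profile (baseTuple mu)) x := by
  rw [← mem_closure_iff_fixes (isOddMono_baseTuple mu)]
  simp only [isLevel_baseTuple]
  rfl

theorem mem_shortestReps_iff (g : W d) :
    g ∈ shortestReps mu ↔ FibreMono (profile (baseTuple mu)) g⁻¹ := by
  rw [fibreMono_inv_iff_forall_length_le (isOddMono_baseTuple mu)]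
  simp only [← mem_parabolic_iff]
  rfl

theorem eq_of_fixes_mul_eq {x g g' : W d} (hx : Fixes (profile (baseTuple mu)) x)
    (hg : g ∈ shortestReps mu) (hg' : g' ∈ shortestReps mu) (h : x * g = g') : x = 1 ∧ g = g' := by
  rw [mem_shortestReps_iff] at hg hg'
  have := hx.eq_one_of_fibreMono (isOddMono_baseTuple mu) hg (h ▸ hg')
  exact ⟨this, by rw [← h, this, one_mul]⟩

/-- Every tuple is `i_μ g` for a unique composition `μ` and a unique shortest representative. -/
theorem existsUnique_act_baseTuple (i : Fin d → SymInterval (m + n)) :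
    ∃! p : Comp m n d × W d, p.2 ∈ shortestReps p.1 ∧ i = act (baseTuple p.1) p.2 := by
  obtain ⟨w, hw⟩ := exists_act_dominant i
  obtain ⟨mu, hmu⟩ := exists_baseTuple_eq hw
  obtain ⟨x, hx, hxw⟩ := exists_fibreMono (isOddMono_baseTuple mu) w⁻¹
  have hi : i = act (baseTuple mu) (x * w⁻¹) := by
    rw [act_mul, (act_eq_self_iff _ _).mpr hx, hmu, ← act_mul, mul_inv_cancel, act_one]
  refine ⟨(mu, x * w⁻¹), ⟨(mem_shortestReps_iff mu _).mpr hxw, hi⟩, ?_⟩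
  rintro ⟨nu, h⟩ ⟨hh, e⟩
  dsimp only at hh e
  generalize x * w⁻¹ = g at *
  have e1 : act (baseTuple mu) (g * h⁻¹) = baseTuple nu := by
    rw [act_mul, ← hi, e, ← act_mul, mul_inv_cancel, act_one]
  have e2 : mu = nu := by
    apply baseTuple_injective
    apply profile_injective
    refine (isOddMono_baseTuple mu).eq_of_comp (isOddMono_baseTuple nu) (g * h⁻¹).1 fun y => ?_
    rw [← profile_act, e1]
  subst e2
  have := eq_of_fixes_mul_eq mu ((act_eq_self_iff _ _).mp e1) hh
    ((mem_shortestReps_iff mu _).mpr hxw) (inv_mul_cancel_right g h)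
  rw [this.2]

/-- The entry of `i_μ` at the position `j` is even if and only if `j` belongs to the even block.
For `n = 0` the even block is everything. -/
theorem baseTuple_le_iff (j : Fin d) : (baseTuple mu j : ℤ) ≤ m ↔ j.1 < partialSum mu m := by
  rcases Nat.eq_zero_or_pos n with rfl | hn
  · have h1 := partialSum_last mu
    have h2 := (baseTuple mu j).2.2
    push_cast at h2
    simp only [add_zero] at h1
    rw [h1]
    exact iff_of_true (by omega) j.2
  · have := lt_baseTuple_iff mu (show m < m + n by omega) j
    omega

end Comp

/-! ### Signed symmetrizers in the Hecke algebra -/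

section Hecke

variable {R : Type*} [CommRing R] {q : R} {d : ℕ}

theorem length_s (k : Fin d) : length (s k) = 1 := by
  have := length_mul_s_of_asc (1 : W d) k (asc_one k)
  rwa [one_mul, length_one] at this

theorem T_mul_T_s {w : W d} {k : Fin d} (h : Asc w k) :
    T R q w * T R q (s k) = T R q (w * s k) :=
  T_mul_T _ _ (by rw [length_mul_s_of_asc _ _ h, length_s])

theorem T_s_mul_T {w : W d} {k : Fin d} (h : Asc w⁻¹ k) :
    T R q (s k) * T R q w = T R q (s k * w) :=
  T_mul_T _ _ (by rw [length_s_mul_of_asc h, length_s, add_comm])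

theorem T_s_mul_T_s (k : Fin d) :
    T R q (s k) * T R q (s k) = q • (1 : Hecke R q d) + (q - 1) • T R q (s k) := by
  have h := T_s_quadratic (R := R) (q := q) k
  rw [Algebra.algebraMap_eq_smul_one, add_mul, mul_sub, one_mul, mul_smul_comm, mul_one] at h
  rw [← sub_eq_zero, ← h]
  module

theorem T_mul_T_s_of_not_asc {w : W d} {k : Fin d} (h : ¬ Asc w k) :
    T R q w * T R q (s k) = q • T R q (w * s k) + (q - 1) • T R q w := by
  have h1 : Asc (w * s k) k := (asc_mul_s w k).mpr h
  have e : T R q w = T R q (w * s k) * T R q (s k) := by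
    rw [T_mul_T_s h1, mul_assoc, s_mul_self, mul_one]
  rw [e, mul_assoc, T_s_mul_T_s, mul_add, mul_smul_comm, mul_smul_comm, mul_one]

theorem T_one : T R q (1 : W d) = 1 := rfl

/-- Induction principle: the `T (s k)` generate the Hecke algebra. -/
theorem T_induction {P : Hecke R q d → Prop} (one : P 1)
    (mul_s : ∀ x k, P x → P (x * T R q (s k))) (w : W d) : P (T R q w) := by
  induction hn : length w generalizing w with
  | zero => rw [eq_one_of_length_eq_zero hn, T_one]; exact one
  | succ n ih =>
    have h1 : w ≠ 1 := by rintro rfl; rw [length_one] at hn; omega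
    obtain ⟨k, hk⟩ := exists_not_asc h1
    have h2 := length_mul_s_of_not_asc w k hk
    have h3 : Asc (w * s k) k := (asc_mul_s w k).mpr hk
    have := mul_s _ k (ih (w * s k) (by omega))
    rwa [T_mul_T_s h3, mul_assoc, s_mul_self, mul_one] at this

/-- Grouping the elements of a finite subgroup into pairs `{w, w s_k}` factors `1 + t T_{s_k}` out
of a sum whose coefficients get multiplied by `t` along ascents. -/
theorem sum_smul_T_eq_mul (G : Subgroup (W d)) {k : Fin d} (hk : s k ∈ G) (c : W d → R) (t : R)
    (hc : ∀ w, Asc w k → c (w * s k) = t * c w) :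
    ∃ y : Hecke R q d, ∑ w ∈ (Set.toFinite (G : Set (W d))).toFinset, c w • T R q w =
      y * (1 + t • T R q (s k)) := by
  classical
  set X := (Set.toFinite (G : Set (W d))).toFinset with hX
  have memX : ∀ w, w ∈ X ↔ w ∈ G := fun w => by rw [hX, Set.Finite.mem_toFinset]; rfl
  refine ⟨∑ w ∈ X with Asc w k, c w • T R q w, ?_⟩
  rw [← Finset.sum_filter_add_sum_filter_not X (fun w => Asc w k), mul_add, mul_one]
  congr 1
  rw [Finset.sum_mul]
  refine Finset.sum_bij' (fun w _ => w * s k) (fun w _ => w * s k) ?_ ?_ ?_ ?_ ?_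
  · intro w hw
    rw [Finset.mem_filter, memX] at hw ⊢
    exact ⟨mul_mem hw.1 hk, (asc_mul_s w k).mpr hw.2⟩
  · intro w hw
    rw [Finset.mem_filter, memX] at hw ⊢
    exact ⟨mul_mem hw.1 hk, by rw [asc_mul_s]; exact not_not.mpr hw.2⟩
  · intro w _; rw [mul_assoc, s_mul_self, mul_one]
  · intro w _; rw [mul_assoc, s_mul_self, mul_one]
  · intro w hw
    rw [Finset.mem_filter] at hw
    have ha : Asc (w * s k) k := (asc_mul_s w k).mpr hw.2
    have h1 := hc _ ha
    rw [mul_assoc, s_mul_self, mul_one] at h1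
    rw [smul_mul_smul_comm, T_mul_T_s ha, mul_assoc, s_mul_self, mul_one, h1, mul_comm]

end Hecke

section xy

variable {m n d : ℕ} (mu : Comp m n d)

theorem mem_evenPart_iff (x : W d) : x ∈ evenPart mu ↔
    Fixes (stepFun fun k => IsParabolicIndex mu k ∧ k.1 < partialSum mu m) x := by
  rw [← mem_closure_iff_fixes_stepFun]
  simp only [and_assoc]
  rfl

theorem evenPart_le : evenPart mu ≤ parabolic mu :=
  Subgroup.closure_mono fun _ ⟨k, hk, _, e⟩ => ⟨k, hk, e⟩

theorem oddPart_le : oddPart mu ≤ parabolic mu :=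
  Subgroup.closure_mono fun _ ⟨k, hk, _, e⟩ => ⟨k, hk, e⟩

theorem oddPart_apply {w : W d} (hw : w ∈ oddPart mu) {x : SymInterval d}
    (h1 : -(partialSum mu m : ℤ) ≤ x) (h2 : (x : ℤ) ≤ partialSum mu m) : w.1 x = x := by
  unfold oddPart at hw
  induction hw using Subgroup.closure_induction with
  | mem w h =>
    obtain ⟨k, -, hk, rfl⟩ := h
    apply Subtype.ext
    rw [coe_s]
    split_ifs <;> omega
  | one => rfl
  | mul u w _ _ hu hw =>
    change u.1 (w.1 x) = x
    rw [hw, hu]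
  | inv w _ hw =>
    conv_lhs => rw [← hw]
    exact inv_apply_apply w x

theorem oddPart_asc {w : W d} (hw : w ∈ oddPart mu) {k : Fin d} (hk : k.1 < partialSum mu m) :
    Asc w k := by
  unfold Asc
  rw [oddPart_apply mu hw (by rw [coe_pt]; omega) (by rw [coe_pt]; omega),
    oddPart_apply mu hw (by rw [coe_pt]; omega) (by rw [coe_pt]; omega), coe_pt, coe_pt]
  omega

theorem length_even_mul_odd {x w : W d} (hx : x ∈ evenPart mu) (hw : w ∈ oddPart mu) :
    length (x * w) = length x + length w := by
  refine ((mem_evenPart_iff mu x).mp hx).length_mul (isOddMono_stepFun _) ?_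
  rw [fibreMono_iff (isOddMono_stepFun _)]
  intro k hk
  rw [isLevel_stepFun] at hk
  exact oddPart_asc mu (inv_mem hw) hk.2

/-- Simple reflections of the even block commute with the odd part, which fixes `[-p..p]` pointwise
for `p = λ_0 + ⋯ + λ_m`. -/
theorem commute_T_s_T {w : W d} (hw : w ∈ oddPart mu) {k : Fin d} (hk : k.1 < partialSum mu m) :
    T A (q : A) (s k) * T A (q : A) w = T A (q : A) w * T A (q : A) (s k) := by
  rw [T_s_mul_T (oddPart_asc mu (inv_mem hw) hk), T_mul_T_s (oddPart_asc mu hw hk)]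
  congr 1
  have h0 := oddPart_asc mu hw hk
  apply s_mul_eq_of_flip_aux _ _ _ h0
  unfold Asc
  change ¬ (((s k).1 (w.1 _) : SymInterval d) : ℤ) < (s k).1 (w.1 _)
  rw [oddPart_apply mu hw (by rw [coe_pt]; omega) (by rw [coe_pt]; omega),
    oddPart_apply mu hw (by rw [coe_pt]; omega) (by rw [coe_pt]; omega)]
  exact fun h => (asc_mul_s (1 : W d) k).mp (by rw [one_mul]; exact h) (asc_one k)

theorem xEven_mul_T {k : Fin d} (hk : IsParabolicIndex mu k) (hlt : k.1 < partialSum mu m) :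
    xEven mu * T A (q : A) (s k) = (q : A) • xEven mu := by
  obtain ⟨y, hy⟩ := sum_smul_T_eq_mul (q := (q : A)) (evenPart mu) (k := k)
    (Subgroup.subset_closure ⟨k, hk, hlt, rfl⟩) (fun _ => (1 : A)) 1 (fun _ _ => by rw [mul_one])
  simp only [one_smul] at hy
  unfold xEven
  rw [hy, mul_assoc, add_mul, T_s_mul_T_s, one_mul, ← mul_smul_comm]
  congr 1
  module

theorem yOdd_mul_T {k : Fin d} (hk : IsParabolicIndex mu k) (hlt : partialSum mu m < k.1) :
    yOdd mu * T A (q : A) (s k) = -yOdd mu := by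
  obtain ⟨y, hy⟩ := sum_smul_T_eq_mul (q := (q : A)) (oddPart mu) (k := k)
    (Subgroup.subset_closure ⟨k, hk, hlt, rfl⟩)
    (fun w => (((-q) ^ (-(length w : ℤ)) : Aˣ) : A)) (((-q)⁻¹ : Aˣ) : A) (fun w hw => by
      rw [length_mul_s_of_asc _ _ hw, ← Units.val_mul]
      congr 1
      rw [← zpow_neg_one, ← zpow_add]
      congr 1
      push_cast
      ring)
  unfold yOdd
  rw [hy, mul_assoc, add_mul, smul_mul_assoc, T_s_mul_T_s, one_mul, ← mul_neg]
  congr 1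
  have e1 : (((-q)⁻¹ : Aˣ) : A) * (q : A) = -1 := by
    have := Units.inv_mul (-q)
    rw [Units.val_neg] at this
    linear_combination -this
  rw [smul_add, smul_smul, smul_smul, mul_sub, e1]
  module

theorem xy_mul_T_of_lt {k : Fin d} (hk : IsParabolicIndex mu k) (hlt : k.1 < partialSum mu m) :
    xy mu * T A (q : A) (s k) = (q : A) • xy mu := by
  have hcomm : yOdd mu * T A (q : A) (s k) = T A (q : A) (s k) * yOdd mu := by
    unfold yOdd
    rw [Finset.sum_mul, Finset.mul_sum]
    refine Finset.sum_congr rfl fun w hw => ?_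
    rw [Set.Finite.mem_toFinset] at hw
    rw [smul_mul_assoc, mul_smul_comm, commute_T_s_T mu hw hlt]
  unfold xy
  rw [mul_assoc, hcomm, ← mul_assoc, xEven_mul_T mu hk hlt, smul_mul_assoc]

theorem xy_mul_T_of_gt {k : Fin d} (hk : IsParabolicIndex mu k) (hlt : partialSum mu m < k.1) :
    xy mu * T A (q : A) (s k) = -xy mu := by
  unfold xy
  rw [mul_assoc, yOdd_mul_T mu hk hlt, mul_neg]

/-- `[xy]_μ T_g` is unitriangular: its coefficient at a shortest representative `g'` is `1` if
`g' = g` and `0` otherwise. -/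
theorem repr_xy_mul_T {g g' : W d} (hg : g ∈ shortestReps mu) (hg' : g' ∈ shortestReps mu) :
    (TBasis A (q : A) d).repr (xy mu * T A (q : A) g) g' = if g = g' then 1 else 0 := by
  classical
  have hT : ∀ w : W d, (TBasis A (q : A) d).repr (T A (q : A) w) g' = if w = g' then 1 else 0 := by
    intro w
    unfold T
    rw [Module.Basis.repr_self, Finsupp.single_apply]
  have hlen : ∀ {x w : W d}, x ∈ evenPart mu → w ∈ oddPart mu →
      T A (q : A) x * T A (q : A) w * T A (q : A) g = T A (q : A) (x * w * g) := by
    intro x w hx hw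
    rw [T_mul_T _ _ (length_even_mul_odd mu hx hw), T_mul_T]
    refine ((mem_parabolic_iff mu _).mp
      (mul_mem (evenPart_le mu hx) (oddPart_le mu hw))).length_mul (isOddMono_baseTuple mu) ?_
    rwa [← mem_shortestReps_iff]
  have expand : xy mu * T A (q : A) g = ∑ x ∈ (Set.toFinite (evenPart mu : Set (W d))).toFinset,
      ∑ w ∈ (Set.toFinite (oddPart mu : Set (W d))).toFinset,
        (((-q) ^ (-(length w : ℤ)) : Aˣ) : A) • T A (q : A) (x * w * g) := by
    unfold xy xEven yOdd
    rw [Finset.sum_mul, Finset.sum_mul]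
    refine Finset.sum_congr rfl fun x hx => ?_
    rw [Finset.mul_sum, Finset.sum_mul]
    refine Finset.sum_congr rfl fun w hw => ?_
    rw [Set.Finite.mem_toFinset] at hx hw
    rw [mul_smul_comm, smul_mul_assoc, hlen hx hw]
  have hone : ∀ {x w : W d}, x ∈ evenPart mu → w ∈ oddPart mu → x * w * g = g' →
      (x = 1 ∧ w = 1) ∧ g = g' := by
    intro x w hx hw e
    have h1 := eq_of_fixes_mul_eq mu ((mem_parabolic_iff mu _).mp
      (mul_mem (evenPart_le mu hx) (oddPart_le mu hw))) hg hg' e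
    have h2 := length_even_mul_odd mu hx hw
    rw [h1.1, length_one] at h2
    exact ⟨⟨eq_one_of_length_eq_zero (by omega), eq_one_of_length_eq_zero (by omega)⟩, h1.2⟩
  rw [expand]
  simp only [map_sum, map_smul, Finsupp.coe_finsetSum, Finset.sum_apply, Finsupp.smul_apply, hT,
    smul_eq_mul]
  rw [Finset.sum_eq_single 1, Finset.sum_eq_single 1]
  · rw [length_one, one_mul, one_mul]; simp
  · intro w hw hne
    rw [Set.Finite.mem_toFinset] at hw
    rw [if_neg fun e => hne (hone (one_mem _) hw e).1.2, mul_zero]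
  · intro h; exact absurd (by rw [Set.Finite.mem_toFinset]; exact one_mem _) h
  · intro x hx hne
    refine Finset.sum_eq_zero fun w hw => ?_
    rw [Set.Finite.mem_toFinset] at hx hw
    rw [if_neg fun e => hne (hone hx hw e).1.1, mul_zero]
  · intro h; exact absurd (by rw [Set.Finite.mem_toFinset]; exact one_mem _) h

/-- If the tuple `i_μ g` has equal entries at `k` and `k + 1` (where the entry at `0` is `0`), then
`g s_k = s_j g` for some `s_j ∈ W_μ`, so that `T_{s_k}` acts on `[xy]_μ T_g` by the scalar by which
`T_{s_j}` acts on `[xy]_μ`. -/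
theorem xy_mul_T_mul_T_s_of_eq {g : W d} (hg : g ∈ shortestReps mu) {k : Fin d}
    (h : profile (act (baseTuple mu) g) (pt k.1 k.2.le) =
      profile (act (baseTuple mu) g) (pt (k.1 + 1) k.2)) :
    xy mu * T A (q : A) g * T A (q : A) (s k) =
      (if |profile (act (baseTuple mu) g) (pt k.1 k.2.le)| ≤ m then (q : A) else -1) •
        (xy mu * T A (q : A) g) := by
  have hg' := (mem_shortestReps_iff mu g).mp hg
  rw [profile_act, profile_act] at h
  obtain ⟨hasc, j, hj, e, habs⟩ := hg'.exists_s_mul_eq (isOddMono_baseTuple mu) h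
  have hlvl := hg'
  rw [fibreMono_iff (isOddMono_baseTuple mu)] at hlvl
  have hjasc := hlvl j hj
  rw [isLevel_baseTuple] at hj
  rw [profile_act, habs, profile_succ, abs_of_nonneg (baseTuple_nonneg mu j), mul_assoc,
    T_mul_T_s hasc, ← e, ← T_s_mul_T hjasc, ← mul_assoc]
  by_cases hlt : j.1 < partialSum mu m
  · rw [xy_mul_T_of_lt mu hj hlt, if_pos ((baseTuple_le_iff mu j).mpr hlt),
      smul_mul_assoc]
  · have hgt : partialSum mu m < j.1 := by
      refine lt_of_le_of_ne (not_lt.mp hlt) fun e => ?_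
      rcases Nat.eq_zero_or_pos n with rfl | hn
      · have h1 := partialSum_last mu
        simp only [add_zero] at h1
        have := j.2
        omega
      · exact hj m (by omega) e.symm
    rw [xy_mul_T_of_gt mu hj hgt, if_neg (mt (baseTuple_le_iff mu j).mp hlt), neg_smul, one_smul,
      neg_mul]

theorem mul_s_mem_shortestReps {g : W d} (hg : g ∈ shortestReps mu) {k : Fin d}
    (h : profile (act (baseTuple mu) g) (pt k.1 k.2.le) ≠
      profile (act (baseTuple mu) g) (pt (k.1 + 1) k.2)) : g * s k ∈ shortestReps mu := by
  rw [mem_shortestReps_iff] at hg ⊢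
  rw [profile_act, profile_act] at h
  exact hg.mul_s (isOddMono_baseTuple mu) h

theorem asc_of_profile_lt {g : W d} {k : Fin d}
    (h : profile (act (baseTuple mu) g) (pt k.1 k.2.le) <
      profile (act (baseTuple mu) g) (pt (k.1 + 1) k.2)) : Asc g k := by
  rw [profile_act, profile_act] at h
  by_contra hn
  have := (isOddMono_baseTuple mu).mono _ _ (not_asc hn).le
  omega

theorem not_asc_of_profile_gt {g : W d} {k : Fin d}
    (h : profile (act (baseTuple mu) g) (pt (k.1 + 1) k.2) <
      profile (act (baseTuple mu) g) (pt k.1 k.2.le)) : ¬ Asc g k := by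
  rw [profile_act, profile_act] at h
  intro hn
  have := (isOddMono_baseTuple mu).mono _ _ (le_of_lt hn)
  omega

theorem one_mem_shortestReps : (1 : W d) ∈ shortestReps mu := fun x _ => by
  rw [length_one]; exact Nat.zero_le _

/-- The `[xy]_μ T_g` span `[xy]_μ H`, since their span is stable under the generators of `H`. -/
theorem xyIdeal_subset_span (y : H d) (hy : y ∈ xyIdeal mu) :
    y ∈ Submodule.span A (Set.range fun g : shortestReps mu => xy mu * T A (q : A) g.1) := by
  set N := Submodule.span A (Set.range fun g : shortestReps mu => xy mu * T A (q : A) g.1) with hN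
  have mem : ∀ g ∈ shortestReps mu, xy mu * T A (q : A) g ∈ N := fun g hg =>
    Submodule.subset_span ⟨⟨g, hg⟩, rfl⟩
  have stable : ∀ k, ∀ x ∈ N, x * T A (q : A) (s k) ∈ N := by
    intro k x hx
    induction hx using Submodule.span_induction with
    | mem x h =>
      obtain ⟨⟨g, hg⟩, rfl⟩ := h
      dsimp only
      rcases lt_trichotomy (profile (act (baseTuple mu) g) (pt k.1 k.2.le))
        (profile (act (baseTuple mu) g) (pt (k.1 + 1) k.2)) with h | h | h
      · rw [mul_assoc, T_mul_T_s (asc_of_profile_lt mu h)]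
        exact mem _ (mul_s_mem_shortestReps mu hg h.ne)
      · rw [xy_mul_T_mul_T_s_of_eq mu hg h]
        exact N.smul_mem _ (mem g hg)
      · rw [mul_assoc, T_mul_T_s_of_not_asc (not_asc_of_profile_gt mu h), mul_add, mul_smul_comm,
          mul_smul_comm]
        exact N.add_mem (N.smul_mem _ (mem _ (mul_s_mem_shortestReps mu hg h.ne')))
          (N.smul_mem _ (mem g hg))
    | zero => rw [zero_mul]; exact N.zero_mem
    | add x y _ _ hx hy => rw [add_mul]; exact N.add_mem hx hy
    | smul r x _ hx => rw [smul_mul_assoc]; exact N.smul_mem _ hx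
  obtain ⟨h, rfl⟩ := Submodule.mem_span_singleton.mp hy
  change xy mu * h.unop ∈ N
  generalize h.unop = h
  have base : ∀ w, xy mu * T A (q : A) w ∈ N := fun w => by
    refine T_induction (P := fun x => xy mu * x ∈ N) ?_ (fun x k hx => ?_) w
    · exact mem 1 (one_mem_shortestReps mu)
    · rw [← mul_assoc]; exact stable k _ hx
  have : (⊤ : Submodule A (H d)) ≤ N.comap (LinearMap.mulLeft A (xy mu)) := by
    rw [← (TBasis A (q : A) d).span_eq, Submodule.span_le]
    rintro _ ⟨w, rfl⟩
    exact base w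
  exact this (Submodule.mem_top (x := h))

/-- The basis element `[xy]_μ T_g` of the right ideal `[xy]_μ H`. -/
noncomputable def xyT (g : W d) : xyIdeal mu := ⟨xy mu * T A (q : A) g, xy_mul_mem mu _⟩

/-- The elements `[xy]_μ T_g`, for the shortest representatives `g`, form a basis of
`[xy]_μ H`. -/
noncomputable def xyBasis : Module.Basis (shortestReps mu) A (xyIdeal mu) :=
  Module.Basis.mk (v := fun g : shortestReps mu => xyT mu g.1)
    (by
      classical
      refine LinearIndependent.of_comp ((xyIdeal mu).subtype.restrictScalars A) ?_
      rw [linearIndependent_iff']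
      intro X c hc g hg
      have h := congrArg (fun y => (TBasis A (q : A) d).repr y g.1) hc
      simp only [Function.comp_apply, LinearMap.restrictScalars_apply, Submodule.subtype_apply,
        map_sum, map_smul, Finsupp.coe_finsetSum, Finset.sum_apply, Finsupp.smul_apply, xyT,
        map_zero, Finsupp.zero_apply] at h
      rw [Finset.sum_congr rfl fun g' _ => by rw [repr_xy_mul_T mu g'.2 g.2],
        Finset.sum_eq_single g] at h
      · simpa using h
      · intro g' _ hne
        rw [if_neg fun e => hne (Subtype.ext e), smul_zero]
      · intro h; exact absurd hg h)
    (by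
      rintro ⟨y, hy⟩ -
      have h := xyIdeal_subset_span mu y hy
      have e : (Set.range fun g : shortestReps mu => xy mu * T A (q : A) g.1) =
          ((xyIdeal mu).subtype.restrictScalars A) ''
            Set.range fun g : shortestReps mu => xyT mu g.1 := by
        rw [← Set.range_comp]; rfl
      rw [e, Submodule.span_image] at h
      obtain ⟨z, hz, rfl⟩ := h
      exact hz)

theorem xyBasis_apply (g : shortestReps mu) : xyBasis mu g = xyT mu g.1 :=
  Module.Basis.mk_apply _ _ _

end xy

/-! ### Signs of tuples -/

section Sign

variable {m n d : ℕ}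

/-- The sum whose class modulo `2` is the parity of a tuple. -/
def oddInversions (i : Fin d → SymInterval (m + n)) : ℕ :=
  (∑ p : Fin d × Fin d with p.1 < p.2 ∧ (i p.1 : ℤ) > i p.2, parity (i p.1) * parity (i p.2)) +
    ∑ p : Fin d × Fin d with p.1 ≤ p.2 ∧ -(i p.1 : ℤ) > i p.2, parity (i p.1) * parity (i p.2)

/-- The sign `(-1)^{parity of i}` of a tuple. -/
noncomputable def tupleSign (i : Fin d → SymInterval (m + n)) : A := (-1) ^ tupleParity i

theorem tupleSign_eq (i : Fin d → SymInterval (m + n)) : tupleSign i = (-1) ^ oddInversions i :=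
  (neg_one_pow_eq_pow_mod_two (oddInversions i)).symm

theorem neg_one_pow_mul_self (k : ℕ) : (-1 : A) ^ k * (-1) ^ k = 1 := by
  rw [← pow_add, Even.neg_one_pow ⟨k, rfl⟩]

theorem parity_neg (a : SymInterval (m + n)) : parity (-a) = parity a := by
  unfold parity
  rw [coe_neg, abs_neg]

theorem parity_mul_self (a : SymInterval (m + n)) : parity a * parity a = parity a := by
  unfold parity
  split_ifs <;> rfl

theorem oddInversions_eq (i : Fin d → SymInterval (m + n)) :
    oddInversions i = ∑ p : Fin d × Fin d,
      ((if p.1 < p.2 ∧ (i p.1 : ℤ) > i p.2 then parity (i p.1) * parity (i p.2) else 0) +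
        if p.1 ≤ p.2 ∧ -(i p.1 : ℤ) > i p.2 then parity (i p.1) * parity (i p.2) else 0) := by
  unfold oddInversions
  rw [Finset.sum_filter, Finset.sum_filter, ← Finset.sum_add_distrib]

/-- Making the positive first entry negative exchanges the two kinds of inversions that involve it
and another entry, and creates the inversion of the first entry with itself. -/
theorem oddInversions_act_s_zero (hd : 0 < d) (i : Fin d → SymInterval (m + n))
    (h : 0 < (i ⟨0, hd⟩ : ℤ)) :
    oddInversions (act i (s ⟨0, hd⟩)) = oddInversions i + parity (i ⟨0, hd⟩) := by
  rw [act_s_zero hd]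
  have e : ∑ p : Fin d × Fin d, (if p = (⟨0, hd⟩, ⟨0, hd⟩) then parity (i ⟨0, hd⟩) else 0) =
      parity (i ⟨0, hd⟩) := by
    rw [Finset.sum_ite_eq', if_pos (Finset.mem_univ _)]
  rw [oddInversions_eq, oddInversions_eq, ← e, ← Finset.sum_add_distrib]
  refine Finset.sum_congr rfl ?_
  rintro ⟨x, y⟩ -
  dsimp only
  by_cases hx : x = ⟨0, hd⟩
  · subst hx
    by_cases hy : y = ⟨0, hd⟩
    · subst hy
      rw [Function.update_self, coe_neg, parity_neg, parity_mul_self, if_pos rfl,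
        if_neg (by omega), if_pos ⟨le_rfl, by omega⟩, if_neg (by omega),
        if_neg (fun hh => by have := hh.2; omega), add_zero, zero_add]
    · have hlt : (⟨0, hd⟩ : Fin d) < y := by
        rw [Fin.lt_def]
        have : y.1 ≠ 0 := fun hh => hy (Fin.ext hh)
        dsimp only
        omega
      rw [Function.update_self, Function.update_of_ne hy, coe_neg, parity_neg, neg_neg,
        if_neg (c := (_, y) = _) (by simp [hy]), add_zero, add_comm]
      simp only [hlt, hlt.le, true_and]
  · rw [Function.update_of_ne hx, if_neg (c := (x, y) = _) (by simp [hx]), add_zero]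
    by_cases hy : y = ⟨0, hd⟩
    · subst hy
      have hgt : (⟨0, hd⟩ : Fin d) < x := by
        rw [Fin.lt_def]
        have : x.1 ≠ 0 := fun hh => hx (Fin.ext hh)
        dsimp only
        omega
      simp only [not_lt_of_gt hgt, not_le_of_gt hgt, false_and, if_false]
    · rw [Function.update_of_ne hy]

/-- Swapping an ascent creates one inversion of the first kind and preserves the number of those of
the second kind. -/
theorem oddInversions_act_s_succ (k : ℕ) (hk : k + 1 < d) (i : Fin d → SymInterval (m + n))
    (h : (i ⟨k, by omega⟩ : ℤ) < i ⟨k + 1, hk⟩) :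
    oddInversions (act i (s ⟨k + 1, hk⟩)) =
      oddInversions i + parity (i ⟨k, by omega⟩) * parity (i ⟨k + 1, hk⟩) := by
  rw [act_s_succ k hk]
  set a : Fin d := ⟨k, by omega⟩ with ha
  set b : Fin d := ⟨k + 1, hk⟩ with hb
  set σ := Equiv.swap a b with hσ
  let f : Fin d × Fin d → ℕ := fun p =>
    if (i p.1 : ℤ) > i p.2 then parity (i p.1) * parity (i p.2) else 0
  let g : Fin d × Fin d → ℕ := fun p =>
    if -(i p.1 : ℤ) > i p.2 then parity (i p.1) * parity (i p.2) else 0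
  have e1 : oddInversions i = ∑ p : Fin d × Fin d,
      ((if p.1 < p.2 then f p else 0) + if p.1 ≤ p.2 then g p else 0) := by
    rw [oddInversions_eq]
    simp only [f, g, ite_and]
  have e2 : oddInversions (i ∘ σ) = ∑ p : Fin d × Fin d,
      ((if σ p.1 < σ p.2 then f p else 0) + if σ p.1 ≤ σ p.2 then g p else 0) := by
    rw [oddInversions_eq, ← Equiv.sum_comp (Equiv.prodCongr σ σ)]
    have : ∀ x, σ (σ x) = x := fun x => Equiv.swap_apply_self a b x
    simp only [f, g, ite_and, Equiv.prodCongr_apply, Prod.map, Function.comp_apply, this]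
  have hval : ∀ x : Fin d, (σ x).1 = if x.1 = k then k + 1 else if x.1 = k + 1 then k else x.1 := by
    intro x
    rw [hσ, Equiv.swap_apply_def]
    simp only [Fin.ext_iff, ha, hb]
    split_ifs <;> rfl
  have term : ∀ p : Fin d × Fin d,
      ((if σ p.1 < σ p.2 then f p else 0) + if σ p.1 ≤ σ p.2 then g p else 0) +
        (if p = (a, b) then f p + g p else 0) =
      ((if p.1 < p.2 then f p else 0) + if p.1 ≤ p.2 then g p else 0) +
        (if p = (b, a) then f p + g p else 0) := by
    rintro ⟨x, y⟩
    generalize f (x, y) = f', g (x, y) = g'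
    simp only [Prod.mk.injEq, Fin.ext_iff, Fin.lt_def, Fin.le_def, hval, ha, hb]
    split_ifs <;> omega
  have key := Finset.sum_congr (rfl : (Finset.univ : Finset (Fin d × Fin d)) = Finset.univ)
    fun p _ => term p
  simp only [Finset.sum_add_distrib] at e1 e2 key
  rw [← e1, ← e2, Finset.sum_ite_eq', Finset.sum_ite_eq', if_pos (Finset.mem_univ _),
    if_pos (Finset.mem_univ _)] at key
  have f1 : f (a, b) = 0 := if_neg (not_lt_of_gt h)
  have f2 : f (b, a) = parity (i a) * parity (i b) := by
    rw [mul_comm]; exact if_pos h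
  have g1 : g (a, b) = g (b, a) := by
    simp only [g]
    rw [mul_comm (parity (i b))]
    congr 1
    apply propext
    constructor <;> intro <;> omega
  omega

theorem act_act_s (i : Fin d → SymInterval (m + n)) (k : Fin d) : act (act i (s k)) (s k) = i := by
  rw [← act_mul, s_mul_self, act_one]

theorem tupleSign_act_s_zero (hd : 0 < d) (i : Fin d → SymInterval (m + n))
    (h : (i ⟨0, hd⟩ : ℤ) ≠ 0) :
    tupleSign (act i (s ⟨0, hd⟩)) = (-1) ^ parity (i ⟨0, hd⟩) * tupleSign i := by
  rw [tupleSign_eq, tupleSign_eq]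
  rcases lt_or_gt_of_ne h with h | h
  · have e := act_s_zero hd i
    have e0 : act i (s ⟨0, hd⟩) ⟨0, hd⟩ = -i ⟨0, hd⟩ := by rw [e, Function.update_self]
    have := oddInversions_act_s_zero hd (act i (s ⟨0, hd⟩)) (by rw [e0, coe_neg]; omega)
    rw [act_act_s, e0, parity_neg] at this
    rw [this, pow_add, mul_left_comm, neg_one_pow_mul_self, mul_one]
  · rw [oddInversions_act_s_zero hd i h, pow_add, mul_comm]

theorem tupleSign_act_s_succ (k : ℕ) (hk : k + 1 < d) (i : Fin d → SymInterval (m + n))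
    (h : (i ⟨k, by omega⟩ : ℤ) ≠ i ⟨k + 1, hk⟩) :
    tupleSign (act i (s ⟨k + 1, hk⟩)) =
      (-1) ^ (parity (i ⟨k, by omega⟩) * parity (i ⟨k + 1, hk⟩)) * tupleSign i := by
  rw [tupleSign_eq, tupleSign_eq]
  rcases lt_or_gt_of_ne h with h | h
  · rw [oddInversions_act_s_succ k hk i h, pow_add, mul_comm]
  · have e := act_s_succ k hk i
    have e0 : act i (s ⟨k + 1, hk⟩) ⟨k, by omega⟩ = i ⟨k + 1, hk⟩ := by
      rw [e, Function.comp_apply, Equiv.swap_apply_left]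
    have e1 : act i (s ⟨k + 1, hk⟩) ⟨k + 1, hk⟩ = i ⟨k, by omega⟩ := by
      rw [e, Function.comp_apply, Equiv.swap_apply_right]
    have := oddInversions_act_s_succ k hk (act i (s ⟨k + 1, hk⟩)) (by rw [e0, e1]; exact h)
    rw [act_act_s, e0, e1] at this
    rw [this, pow_add, mul_left_comm, mul_comm (parity (i ⟨k, _⟩)), neg_one_pow_mul_self, mul_one]

end Sign

/-! ### The isomorphism and the transported action -/

section Iso

variable {m n d : ℕ}

/-- The basis `(-1)^{parity of i} eBold i` of the tensor power. -/
noncomputable def signedBasis (m n d : ℕ) :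
    Module.Basis (Fin d → SymInterval (m + n)) A (TensorV m n d) :=
  (Basis.piTensorProduct fun _ : Fin d => Finsupp.basisSingleOne).unitsSMul
    fun i => (-1 : Aˣ) ^ tupleParity i * v ^ tupleLength i

theorem signedBasis_apply (i : Fin d → SymInterval (m + n)) :
    signedBasis m n d i = (-1 : A) ^ tupleParity i • eBold i := by
  unfold signedBasis eBold
  rw [Module.Basis.unitsSMul_apply, Basis.piTensorProduct_apply, Units.smul_def, Units.val_mul,
    mul_smul]
  simp

/-- The direct sum of the right ideals `[xy]_λ H`. -/
abbrev XYSum (m n d : ℕ) : Type := DirectSum (Comp m n d) fun lam => xyIdeal lam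

/-- The basis of the direct sum formed by the `[xy]_μ T_g`. -/
noncomputable def sumBasis (m n d : ℕ) :
    Module.Basis (Σ mu : Comp m n d, shortestReps mu) A (XYSum m n d) :=
  DFinsupp.basis fun mu : Comp m n d => xyBasis mu

theorem sumBasis_apply (mu : Comp m n d) (g : shortestReps mu) :
    sumBasis m n d ⟨mu, g⟩ = DirectSum.of (fun lam => xyIdeal lam) mu (xyT mu g.1) := by
  classical
  rw [Module.Basis.apply_eq_iff]
  refine Finsupp.ext fun ⟨nu, h⟩ => ?_
  change (xyBasis nu).repr (DirectSum.of (fun lam => xyIdeal lam) mu (xyT mu g.1) nu) h = _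
  by_cases e : mu = nu
  · subst e
    rw [DirectSum.of_eq_same, ← xyBasis_apply, Module.Basis.repr_self, Finsupp.single_apply,
      Finsupp.single_apply]
    congr 1
    simp
  · rw [DirectSum.of_eq_of_ne _ _ _ (Ne.symm e), map_zero, Finsupp.zero_apply,
      Finsupp.single_eq_of_ne]
    exact fun h' => e (congrArg Sigma.fst h').symm

/-- The parametrization of tuples by pairs of a composition and a shortest representative. -/
noncomputable def tupleEquiv (m n d : ℕ) :
    (Σ mu : Comp m n d, shortestReps mu) ≃ (Fin d → SymInterval (m + n)) :=
  Equiv.ofBijective (fun p => act (baseTuple p.1) p.2.1) (by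
    constructor
    · rintro ⟨mu, g, hg⟩ ⟨nu, h, hh⟩ e
      dsimp only at e
      have := (existsUnique_act_baseTuple (act (baseTuple mu) g)).unique
        (y₁ := (mu, g)) (y₂ := (nu, h)) ⟨hg, rfl⟩ ⟨hh, e⟩
      obtain ⟨rfl, rfl⟩ := Prod.mk.inj this
      rfl
    · intro i
      obtain ⟨⟨mu, g⟩, ⟨hg, e⟩, -⟩ := existsUnique_act_baseTuple i
      exact ⟨⟨mu, g, hg⟩, e.symm⟩)

/-- The linear isomorphism `(-1)^{parity of i} eBold i ↦ [xy]_μ T_g` for `i = i_μ g`. -/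
noncomputable def tensorEquiv (m n d : ℕ) : TensorV m n d ≃ₗ[A] XYSum m n d :=
  (signedBasis m n d).equiv (sumBasis m n d) (tupleEquiv m n d).symm

theorem tensorEquiv_signed (mu : Comp m n d) {g : W d} (hg : g ∈ shortestReps mu) :
    tensorEquiv m n d ((-1 : A) ^ tupleParity (act (baseTuple mu) g) •
      eBold (act (baseTuple mu) g)) = DirectSum.of (fun lam => xyIdeal lam) mu (xyT mu g) := by
  rw [← signedBasis_apply]
  unfold tensorEquiv
  have e : (tupleEquiv m n d).symm (act (baseTuple mu) g) = ⟨mu, g, hg⟩ := by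
    rw [Equiv.symm_apply_eq]; rfl
  rw [Module.Basis.equiv_apply, e, sumBasis_apply]

theorem tensorEquiv_eBold (mu : Comp m n d) {g : W d} (hg : g ∈ shortestReps mu) :
    tensorEquiv m n d (eBold (act (baseTuple mu) g)) =
      tupleSign (act (baseTuple mu) g) • DirectSum.of (fun lam => xyIdeal lam) mu (xyT mu g) := by
  rw [← tensorEquiv_signed mu hg, map_smul, smul_smul]
  unfold tupleSign
  rw [neg_one_pow_mul_self, one_smul]

theorem op_smul_of (h : H d) (mu : Comp m n d) (y : xyIdeal mu) :
    MulOpposite.op h • DirectSum.of (fun lam => xyIdeal lam) mu y =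
      DirectSum.of (fun lam => xyIdeal lam) mu (MulOpposite.op h • y) :=
  ((DirectSum.lof (H d)ᵐᵒᵖ (Comp m n d) (fun lam => xyIdeal lam) mu).map_smul _ y).symm

theorem smul_of (r : A) (mu : Comp m n d) (y : xyIdeal mu) :
    r • DirectSum.of (fun lam => xyIdeal lam) mu y =
      DirectSum.of (fun lam => xyIdeal lam) mu (r • y) :=
  ((DirectSum.lof A (Comp m n d) (fun lam => xyIdeal lam) mu).map_smul _ y).symm

theorem op_smul_smul (h : (H d)ᵐᵒᵖ) (r : A) (y : XYSum m n d) : h • r • y = r • h • y :=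
  smul_algebra_smul_comm r h y

/-- Right multiplication by `T (s k)` in the coordinates of the direct sum. -/
theorem op_smul_tensorEquiv_eBold (mu : Comp m n d) {g : W d} (hg : g ∈ shortestReps mu)
    (k : Fin d) :
    MulOpposite.op (T A (q : A) (s k)) • tensorEquiv m n d (eBold (act (baseTuple mu) g)) =
      tupleSign (act (baseTuple mu) g) • DirectSum.of (fun lam => xyIdeal lam) mu
        (MulOpposite.op (T A (q : A) (s k)) • xyT mu g) := by
  rw [tensorEquiv_eBold mu hg, op_smul_smul, op_smul_of]

theorem tensorEquiv_eBold_act_s {mu : Comp m n d} {g : W d} {k : Fin d}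
    (hg : g * s k ∈ shortestReps mu) {ε : A} (hε : ε * ε = 1)
    (hs : tupleSign (act (act (baseTuple mu) g) (s k)) = ε * tupleSign (act (baseTuple mu) g)) :
    ε • tensorEquiv m n d (eBold (act (act (baseTuple mu) g) (s k))) =
      tupleSign (act (baseTuple mu) g) •
        DirectSum.of (fun lam => xyIdeal lam) mu (xyT mu (g * s k)) := by
  rw [← act_mul] at hs ⊢
  rw [tensorEquiv_eBold mu hg, hs, smul_smul, ← mul_assoc, hε, one_mul]

/-- The first case of the formulas for the action. For `k = 0` the entry `profile i 0` is `0`, which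
makes the formulas for `s_0` an instance of those for `s_k` up to the sign `ε`. -/
theorem op_smul_tensorEquiv_of_lt {i : Fin d → SymInterval (m + n)} {k : Fin d} {ε : A}
    (h : profile i (pt k.1 k.2.le) < profile i (pt (k.1 + 1) k.2)) (hε : ε * ε = 1)
    (hs : tupleSign (act i (s k)) = ε * tupleSign i) :
    MulOpposite.op (T A (q : A) (s k)) • tensorEquiv m n d (eBold i) =
      ε • tensorEquiv m n d (eBold (act i (s k))) := by
  obtain ⟨⟨mu, g⟩, ⟨hg, rfl⟩, -⟩ := existsUnique_act_baseTuple i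
  dsimp only at *
  have e : MulOpposite.op (T A (q : A) (s k)) • xyT mu g = xyT mu (g * s k) := by
    apply Subtype.ext
    change xy mu * T A (q : A) g * T A (q : A) (s k) = xy mu * T A (q : A) (g * s k)
    rw [mul_assoc, T_mul_T_s (asc_of_profile_lt mu h)]
  rw [op_smul_tensorEquiv_eBold mu hg, e,
    tensorEquiv_eBold_act_s (mul_s_mem_shortestReps mu hg h.ne) hε hs]

theorem op_smul_tensorEquiv_of_eq {i : Fin d → SymInterval (m + n)} {k : Fin d}
    (h : profile i (pt k.1 k.2.le) = profile i (pt (k.1 + 1) k.2)) :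
    MulOpposite.op (T A (q : A) (s k)) • tensorEquiv m n d (eBold i) =
      (if |profile i (pt k.1 k.2.le)| ≤ m then (q : A) else -1) •
        tensorEquiv m n d (eBold i) := by
  obtain ⟨⟨mu, g⟩, ⟨hg, rfl⟩, -⟩ := existsUnique_act_baseTuple i
  dsimp only at *
  have e : MulOpposite.op (T A (q : A) (s k)) • xyT mu g =
      (if |profile (act (baseTuple mu) g) (pt k.1 k.2.le)| ≤ m then (q : A) else -1) • xyT mu g :=
    Subtype.ext (xy_mul_T_mul_T_s_of_eq mu hg h)
  rw [op_smul_tensorEquiv_eBold mu hg, e, tensorEquiv_eBold mu hg, ← smul_of, smul_comm]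

theorem op_smul_tensorEquiv_of_gt {i : Fin d → SymInterval (m + n)} {k : Fin d} {ε : A}
    (h : profile i (pt (k.1 + 1) k.2) < profile i (pt k.1 k.2.le)) (hε : ε * ε = 1)
    (hs : tupleSign (act i (s k)) = ε * tupleSign i) :
    MulOpposite.op (T A (q : A) (s k)) • tensorEquiv m n d (eBold i) =
      (ε * (q : A)) • tensorEquiv m n d (eBold (act i (s k))) +
        ((q : A) - 1) • tensorEquiv m n d (eBold i) := by
  obtain ⟨⟨mu, g⟩, ⟨hg, rfl⟩, -⟩ := existsUnique_act_baseTuple i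
  dsimp only at *
  have e : MulOpposite.op (T A (q : A) (s k)) • xyT mu g =
      (q : A) • xyT mu (g * s k) + ((q : A) - 1) • xyT mu g := by
    apply Subtype.ext
    change xy mu * T A (q : A) g * T A (q : A) (s k) =
      (q : A) • (xy mu * T A (q : A) (g * s k)) + ((q : A) - 1) • (xy mu * T A (q : A) g)
    rw [mul_assoc, T_mul_T_s_of_not_asc (not_asc_of_profile_gt mu h), mul_add, mul_smul_comm,
      mul_smul_comm]
  rw [op_smul_tensorEquiv_eBold mu hg, e, mul_comm ε, mul_smul,
    tensorEquiv_eBold_act_s (mul_s_mem_shortestReps mu hg h.ne') hε hs, tensorEquiv_eBold mu hg,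
    smul_comm (q : A), smul_comm ((q : A) - 1), map_add, ← smul_of, ← smul_of, smul_add]

/-- The action of `H` on the tensor power obtained by transport from the direct sum. -/
noncomputable def transportedAction (m n d : ℕ) :
    (H d)ᵐᵒᵖ →ₐ[A] Module.End A (TensorV m n d) :=
  ((tensorEquiv m n d).symm.conjAlgEquiv A).toAlgHom.comp (Algebra.lsmul A A (XYSum m n d))

theorem tensorEquiv_transportedAction (h : (H d)ᵐᵒᵖ) (x : TensorV m n d) :
    tensorEquiv m n d (transportedAction m n d h x) = h • tensorEquiv m n d x :=
  (tensorEquiv m n d).apply_symm_apply _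

theorem ite_eq_sign_mul_pow (a : SymInterval (m + n)) :
    (if |(a : ℤ)| ≤ m then (q : A) else -1) = (-1) ^ parity a * (q : A) ^ (1 - parity a) := by
  unfold parity
  split_ifs <;> simp

theorem isSignedAction_transportedAction : IsSignedAction (transportedAction m n d) where
  succ k hk i a b ha hb := by
    subst ha hb
    apply (tensorEquiv m n d).injective
    rw [tensorEquiv_transportedAction]
    have e1 := profile_succ i ⟨k, by omega⟩
    have e2 := profile_succ i ⟨k + 1, hk⟩
    have hε := neg_one_pow_mul_self (parity (i ⟨k, by omega⟩) * parity (i ⟨k + 1, hk⟩))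
    split_ifs with h1 h2
    · rw [map_smul]
      exact op_smul_tensorEquiv_of_lt (by rw [e2]; exact e1.trans_lt h1) hε
        (tupleSign_act_s_succ k hk i h1.ne)
    · rw [map_smul, ← ite_eq_sign_mul_pow, ← e1]
      exact op_smul_tensorEquiv_of_eq (by rw [e2]; exact e1.trans h2)
    · rw [map_add, map_smul, map_smul]
      exact op_smul_tensorEquiv_of_gt (by rw [e2]; exact lt_of_lt_of_eq (by omega) e1.symm) hε
        (tupleSign_act_s_succ k hk i h2)
  zero hd i a ha := by
    subst ha
    apply (tensorEquiv m n d).injective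
    rw [tensorEquiv_transportedAction]
    have e1 := profile_zero i
    have e2 := profile_succ i ⟨0, hd⟩
    have hε := neg_one_pow_mul_self (parity (i ⟨0, hd⟩))
    split_ifs with h1 h2
    · rw [map_smul]
      exact op_smul_tensorEquiv_of_lt (by rw [e2]; exact e1.trans_lt h1) hε
        (tupleSign_act_s_zero hd i (by omega))
    · rw [map_smul]
      refine (op_smul_tensorEquiv_of_eq (by rw [e2]; exact e1.trans h2.symm)).trans ?_
      rw [if_pos]
      change |profile i (pt 0 (Nat.zero_le d))| ≤ _
      rw [e1]
      simp
    · rw [map_add, map_smul, map_smul]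
      exact op_smul_tensorEquiv_of_gt (by rw [e2]; exact lt_of_lt_of_eq (by omega) e1.symm) hε
        (tupleSign_act_s_zero hd i h2)

/-- The elements `eBold i` span the tensor power and the `T (s k)` generate the Hecke algebra, so the
formulas determine the action. -/
theorem IsSignedAction.unique {f g : (H d)ᵐᵒᵖ →ₐ[A] Module.End A (TensorV m n d)}
    (hf : IsSignedAction f) (hg : IsSignedAction g) : f = g := by
  have gen : ∀ k : Fin d, f (MulOpposite.op (T A (q : A) (s k))) =
      g (MulOpposite.op (T A (q : A) (s k))) := by
    rintro ⟨k, hk⟩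
    refine (signedBasis m n d).ext fun i => ?_
    rw [signedBasis_apply, map_smul, map_smul]
    congr 1
    cases k with
    | zero => rw [hf.zero hk i _ rfl, hg.zero hk i _ rfl]
    | succ k => rw [hf.succ k hk i _ _ rfl rfl, hg.succ k hk i _ _ rfl rfl]
  have hT : ∀ w, f (MulOpposite.op (T A (q : A) w)) = g (MulOpposite.op (T A (q : A) w)) := by
    refine T_induction (P := fun x => f (MulOpposite.op x) = g (MulOpposite.op x)) ?_ ?_
    · rw [MulOpposite.op_one, map_one, map_one]
    · intro x k hx
      rw [MulOpposite.op_mul, map_mul, map_mul, hx, gen]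
  have hlin : f.toLinearMap ∘ₗ (MulOpposite.opLinearEquiv A).toLinearMap =
      g.toLinearMap ∘ₗ (MulOpposite.opLinearEquiv A).toLinearMap :=
    (TBasis A (q : A) d).ext hT
  refine AlgHom.ext fun h => ?_
  exact LinearMap.congr_fun hlin h.unop

end Iso

end TypeB

theorem theorem2p12 (m n d : ℕ) (hd : 0 < d) :
    (∀ i : Fin d → TypeB.SymInterval (m + n), ∃! p : TypeB.Comp m n d × TypeB.W d,
      p.2 ∈ TypeB.shortestReps p.1 ∧ i = TypeB.act (TypeB.baseTuple p.1) p.2) ∧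
    (∃! act_H : (TypeB.H d)ᵐᵒᵖ →ₐ[TypeB.A] Module.End TypeB.A (TypeB.TensorV m n d),
      TypeB.IsSignedAction act_H) ∧
    ∀ act_H : (TypeB.H d)ᵐᵒᵖ →ₐ[TypeB.A] Module.End TypeB.A (TypeB.TensorV m n d),
      TypeB.IsSignedAction act_H →
      ∃ φ : TypeB.TensorV m n d ≃ₗ[TypeB.A]
          DirectSum (TypeB.Comp m n d) fun lam => TypeB.xyIdeal lam,
        (∀ (x : TypeB.TensorV m n d) (h : TypeB.H d),
          φ (act_H (MulOpposite.op h) x) = MulOpposite.op h • φ x) ∧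
        ∀ (i : Fin d → TypeB.SymInterval (m + n)) (mu : TypeB.Comp m n d) (g : TypeB.W d),
          g ∈ TypeB.shortestReps mu → i = TypeB.act (TypeB.baseTuple mu) g →
          φ ((-1 : TypeB.A) ^ TypeB.tupleParity i • TypeB.eBold i) =
            DirectSum.of (fun lam => TypeB.xyIdeal lam) mu
              ⟨TypeB.xy mu * TypeB.T TypeB.A (TypeB.q : TypeB.A) g, TypeB.xy_mul_mem mu _⟩ := by
  refine ⟨TypeB.existsUnique_act_baseTuple, ⟨TypeB.transportedAction m n d,
    TypeB.isSignedAction_transportedAction,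
    fun f hf => hf.unique TypeB.isSignedAction_transportedAction⟩, fun f hf => ?_⟩
  refine ⟨TypeB.tensorEquiv m n d, fun x h => ?_, ?_⟩
  · rw [hf.unique TypeB.isSignedAction_transportedAction]
    exact TypeB.tensorEquiv_transportedAction _ x
  · rintro i mu g hg rfl
    exact TypeB.tensorEquiv_signed mu hg
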